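/- Let $\mathbb{E}_1$ denote the associative operad, presented by its category of operators: objects are finite pointed sets, and a morphism $S \to T$ is a pointed map $f : S \to T$ together with a linear ordering of $f^{-1}(t)$ for every $t \in T$ different from the base point; the fibres of a composite are ordered lexicographically. For a pointed set $S$ let $S^\circ$ be $S$ without its base point. A morphism is active if only the base point is sent to the base point; a multi-morphism of arity $k$ is an active morphism $\gamma : x \to z$ with $|x^\circ| = k$ and $|z^\circ| = 1$. For such a $\gamma$ let $\mathrm{Fact}_{\mathbb{E}_1}(\gamma) = \big((\mathbb{E}_1^{\mathrm{act}})_{/z}\big)_{\gamma/}$ be the category of factorizations $x \to y \to z$ of $\gamma$ into active morphisms, and let $\mathrm{Part}_{\mathbb{E}_1}(\gamma)$ be its full subcategory on the factorizations for which $x^\circ \to y^\circ$ is surjective and $1 < |y^\circ| < k$. The partition complex $\Pi^{\mathbb{E}_1}_\gamma$ is the geometric realization of the nerve of $\mathrm{Part}_{\mathbb{E}_1}(\gamma)$. **Lemma.** Let $k \ge 2$ and let $\gamma$ be a multi-morphism in $\mathbb{E}_1$ of arity $k$. Then $\Pi^{\mathbb{E}_1}_\gamma$ is homotopy equivalent to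 the sphere $S^{k-3}$ (the unit sphere of $\mathbb{R}^{k-2}$, which is empty for $k = 2$). Moreover, $\mathrm{Part}_{\mathbb{E}_1}(\gamma)$ is equivalent, as a category, to the opposite of the poset of non-empty proper subsets of $\{0, \dots, k-2\}$, ordered by inclusion. -/

import Mathlib

open CategoryTheory

universe v w u

/-! ### Finite pointed sets -/

/-- The category of finite pointed sets. -/
abbrev FinPtd : Type (u + 1) := ObjectProperty.FullSubcategory (C := Pointed.{u}) (fun X => Finite X)

namespace FinPtd

/-- The underlying map of a morphism of finite pointed sets. -/
def map {X Y : FinPtd.{u}} (f : X ⟶ Y) : X.obj → Y.obj := f.hom.toFun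

theorem map_point {X Y : FinPtd.{u}} (f : X ⟶ Y) : map f X.obj.point = Y.obj.point :=
  f.hom.map_point

/-- The finite set `X°` of elements different from the base point. -/
def Unpointed (X : FinPtd.{u}) : Type u := {a : X.obj // a ≠ X.obj.point}

instance (X : FinPtd.{u}) : Finite X.Unpointed :=
  haveI : Finite X.obj := X.property
  inferInstanceAs (Finite {a : X.obj // a ≠ X.obj.point})

/-- A map of finite pointed sets is active if only the base point is sent to the base point. -/
def active : MorphismProperty FinPtd.{u} :=
  fun X Y f => ∀ a : X.obj, map f a = Y.obj.point → a = X.obj.point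

instance : active.{u}.IsMultiplicative where
  id_mem _ _ h := h
  comp_mem f _ hf hg a h := hf a (hg (map f a) h)

end FinPtd

/-! ### Active morphisms, multi-morphisms and partitions over finite pointed sets

Here `p : O ⥤ FinPtd` is the structure functor of an operad presented as a category of operators. -/

section Operad

variable {O : Type w} [Category.{v} O] (p : O ⥤ FinPtd.{u})

/-- The wide subcategory of `O` on the active morphisms. -/
abbrev Act : Type w := WideSubcategory (FinPtd.active.{u}.inverseImage p)

/-- The functor `x ↦ ⟨x⟩°` to finite sets, defined on active morphisms. -/
def actToFin : Act p ⥤ FintypeCat.{u} where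
  obj x := FintypeCat.of (p.obj x.obj).Unpointed
  map f := FintypeCat.homMk fun a => ⟨FinPtd.map (p.map f.hom) a.1, fun h => a.2 (f.property a.1 h)⟩
  map_id x := by
    ext a
    refine Subtype.ext ?_
    change FinPtd.map (p.map (𝟙 x.obj)) a.1 = a.1
    rw [p.map_id]
    rfl
  map_comp f g := by
    ext a
    refine Subtype.ext ?_
    change FinPtd.map (p.map (f.hom ≫ g.hom)) a.1 = _
    rw [p.map_comp]
    rfl

/-- A multi-morphism of arity `k`: an active morphism `x ⟶ z` such that `⟨x⟩°` has `k` elements and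
`⟨z⟩°` has exactly one element. -/
structure MultiMorphism (k : ℕ) where
  source : Act p
  target : Act p
  hom : source ⟶ target
  card_source : Nat.card ((actToFin p).obj source) = k
  card_target : Nat.card ((actToFin p).obj target) = 1

variable {p}

/-- The category of factorizations of an active morphism `μ : x ⟶ z` into active morphisms
`x ⟶ y ⟶ z`. -/
abbrev FactCat {x z : Act p} (μ : x ⟶ z) := Under (Over.mk μ)

/-- The functor sending a factorization `x ⟶ y ⟶ z` to the map of finite sets `⟨x⟩° → ⟨y⟩°`. -/
def factToFin {x z : Act p} (μ : x ⟶ z) : FactCat μ ⥤ Under ((actToFin p).obj x) :=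
  Under.post (X := Over.mk μ) (Over.forget z ⋙ actToFin p)

end Operad

/-- The maps `S → A` of finite sets which are surjective with `1 < |A| < |S|`. -/
def IsPartition (S : FintypeCat.{u}) : ObjectProperty (Under S) :=
  fun A => Function.Surjective A.hom ∧ 1 < Nat.card A.right ∧ Nat.card A.right < Nat.card S

section Operad

variable {O : Type w} [Category.{v} O] {p : O ⥤ FinPtd.{u}}

/-- The partition category of `μ : x ⟶ z`. The pullback of the full subcategory of proper
partitions of `⟨x⟩°` along `factToFin μ` is the full subcategory of `FactCat μ` on the objects which
are sent to a proper partition. -/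
abbrev PartCat {x z : Act p} (μ : x ⟶ z) :=
  ((IsPartition ((actToFin p).obj x)).inverseImage (factToFin μ)).FullSubcategory

/-- The partition complex of `μ`: the geometric realization of the nerve of the partition
category. -/
noncomputable def partitionComplex {x z : Act p} (μ : x ⟶ z) : TopCat :=
  SSet.toTop.obj (nerve (PartCat μ))

end Operad

/-! ### The operad `E₁` -/

/-- Objects of the category of operators of the operad `E₁` (the associative operad): finite
pointed sets. -/
structure Assoc : Type (u + 1) where
  pt : FinPtd.{u}

namespace Assoc

/-- A morphism: a map `f` of finite pointed sets with a linear ordering on `f ⁻¹ {t}` for every `t`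
different from the base point. The orderings are recorded by one relation `le` on the source,
namely their disjoint union; it relates only elements of a common fibre over a non-base point. -/
@[ext]
structure Hom (X Y : Assoc.{u}) : Type u where
  map : X.pt ⟶ Y.pt
  le : X.pt.obj → X.pt.obj → Prop
  fiber : ∀ {a b}, le a b → FinPtd.map map a = FinPtd.map map b ∧ FinPtd.map map a ≠ Y.pt.obj.point
  refl : ∀ a, FinPtd.map map a ≠ Y.pt.obj.point → le a a
  trans : ∀ {a b c}, le a b → le b c → le a c
  antisymm : ∀ {a b}, le a b → le b a → a = b
  total : ∀ {a b}, FinPtd.map map a = FinPtd.map map b → FinPtd.map map a ≠ Y.pt.obj.point →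
    le a b ∨ le b a

/-- Composition of maps, with the lexicographic ordering on the fibres of the composite. -/
def Hom.comp {X Y Z : Assoc.{u}} (f : Hom X Y) (g : Hom Y Z) : Hom X Z where
  map := f.map ≫ g.map
  le a b := g.le (FinPtd.map f.map a) (FinPtd.map f.map b) ∧
    (FinPtd.map f.map a = FinPtd.map f.map b → f.le a b)
  fiber h := g.fiber h.1
  refl a h := by
    have h' : FinPtd.map g.map (FinPtd.map f.map a) ≠ Z.pt.obj.point := h
    exact ⟨g.refl _ h', fun _ => f.refl _ fun e => h' (by rw [e, FinPtd.map_point])⟩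
  trans := by
    rintro a b c ⟨h₁, h₂⟩ ⟨h₃, h₄⟩
    refine ⟨g.trans h₁ h₃, fun e => ?_⟩
    have e' : FinPtd.map f.map a = FinPtd.map f.map b := g.antisymm h₁ (e ▸ h₃)
    exact f.trans (h₂ e') (h₄ (e'.symm.trans e))
  antisymm := by
    rintro a b ⟨h₁, h₂⟩ ⟨h₃, h₄⟩
    have e := g.antisymm h₁ h₃
    exact f.antisymm (h₂ e) (h₄ e.symm)
  total := by
    intro a b h h'
    change FinPtd.map g.map (FinPtd.map f.map a) = FinPtd.map g.map (FinPtd.map f.map b) at h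
    change FinPtd.map g.map (FinPtd.map f.map a) ≠ Z.pt.obj.point at h'
    by_cases e : FinPtd.map f.map a = FinPtd.map f.map b
    · have hn : FinPtd.map f.map a ≠ Y.pt.obj.point := fun e' => h' (by rw [e', FinPtd.map_point])
      have hr := g.refl _ h'
      rcases f.total e hn with l | l
      · exact Or.inl ⟨e ▸ hr, fun _ => l⟩
      · exact Or.inr ⟨e ▸ hr, fun _ => l⟩
    · rcases g.total h h' with l | l
      · exact Or.inl ⟨l, fun e' => absurd e' e⟩
      · exact Or.inr ⟨l, fun e' => absurd e'.symm e⟩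

instance : Category.{u} Assoc.{u} where
  Hom := Hom
  id X :=
    { map := 𝟙 X.pt
      le := fun a b => a = b ∧ a ≠ X.pt.obj.point
      fiber := by rintro a b ⟨rfl, h⟩; exact ⟨rfl, h⟩
      refl := fun a h => ⟨rfl, h⟩
      trans := by rintro a b c ⟨rfl, h⟩ ⟨rfl, _⟩; exact ⟨rfl, h⟩
      antisymm := fun h _ => h.1
      total := fun e h => Or.inl ⟨e, h⟩ }
  comp := Hom.comp
  id_comp {X Y} f := by
    refine Hom.ext (Category.id_comp _) ?_
    funext a b
    refine propext ⟨fun h => h.1, fun h => ⟨h, fun e => ⟨e, fun e' => (f.fiber h).2 ?_⟩⟩⟩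
    change a = X.pt.obj.point at e'
    rw [e', FinPtd.map_point]
  comp_id {X Y} f := by
    refine Hom.ext (Category.comp_id _) ?_
    funext a b
    exact propext ⟨fun h => h.2 h.1.1, fun h => ⟨f.fiber h, fun _ => h⟩⟩
  assoc {W X Y Z} f g h := by
    refine Hom.ext (Category.assoc _ _ _) ?_
    funext a b
    have e : ∀ {a b}, FinPtd.map f.map a = FinPtd.map f.map b →
        FinPtd.map (f.map ≫ g.map) a = FinPtd.map (f.map ≫ g.map) b :=
      fun e => congrArg (FinPtd.map g.map) e
    exact propext
      ⟨fun H => ⟨⟨H.1, fun e₁ => (H.2 e₁).1⟩, fun e₁ => (H.2 (e e₁)).2 e₁⟩,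
        fun H => ⟨H.1.1, fun e₁ => ⟨H.1.2 e₁, H.2⟩⟩⟩

/-- The structure functor to finite pointed sets, forgetting the orderings. -/
def toFinPtd : Assoc.{u} ⥤ FinPtd.{u} where
  obj X := X.pt
  map f := f.map

end Assoc

/-!
The active morphism `γ : x ⟶ z` orders the `k` elements of `x°` linearly. In a factorization
`x ⟶ y ⟶ z` of `γ` the ordering of `x°` is lexicographic, so the fibres of `x° → y°` are intervals,
and the orderings which are part of the two factors are determined by `γ`. A surjective
factorization is therefore the same as the set of the *cuts* among the `k - 1` consecutive pairs of
elements of `x°`, namely the pairs it separates; morphisms of factorizations remove cuts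
(`Assoc.exists_factor`, `Assoc.fn_eq_of_cuts_subset`), and every set of cuts occurs
(`Assoc.toLabels_comp_ofLabels`). The condition `1 < |y°| < k` says that the cut set is non-empty
and proper. This gives the equivalence of categories `nonempty_partCat_equivalence`.

For the homotopy type, let `D` be a finite poset. Its order complex is described concretely by
barycentric coordinates, as the subspace `OrderComplex D` of a simplex of those points whose support
is a chain. A functor `D ⥤ C` induces a continuous map from this space to the realization of the
nerve of `C` (`Realization.realize`), and a functor `C ⥤ D` induces a map in the other direction.
For an equivalence `C ≌ D` the composite on the order complex is the identity, and the other one is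
homotopic to the identity (`Realization.nonempty_homotopyEquiv_orderComplex`). The homotopy is
defined simplex by simplex, as the composite of `Δⁿ × [0, 1] → OrderComplex ([n] × [1])`, the prism
decomposition, with the map induced by the functor `[n] × [1] ⥤ C` coming from the unit of the
equivalence.

Finally, a point `w` of the order complex of the poset of non-empty proper subsets of `{0, …, d}` is
the same as its height function `∑ w(S) 1_S`, and the functions which occur are those with minimum
`0` and maximum `1` (`ProperSubset.height_injective`, `ProperSubset.exists_height_eq`). Modulo
constants, each ray of `ℝᵈ⁺¹ / ℝ ≅ ℝᵈ` contains exactly one such function, so radial projection is a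
homeomorphism to the unit sphere of `ℝᵈ` (`ProperSubset.homeomorphSphere`).
-/

/-! ### Maps out of a geometric realization -/

namespace Realization

open Simplicial Opposite

/-- The characteristic map `Δⁿ → |X|` of an `n`-simplex of a simplicial set `X`. -/
noncomputable def cell {X : SSet.{w}} {n : ℕ} (x : X.obj (op ⦋n⦌)) :
    C(stdSimplex ℝ (Fin (n + 1)), SSet.toTop.obj X) :=
  TopCat.toSSetObjEquiv _ _ ((sSetTopAdj.unit.app X).app (op ⦋n⦌) x)

theorem cell_map {X : SSet.{w}} {m n : ℕ} (f : (⦋m⦌ : SimplexCategory) ⟶ ⦋n⦌)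
    (x : X.obj (op ⦋n⦌)) (t : stdSimplex ℝ (Fin (m + 1))) :
    cell (X.map f.op x) t = cell x (stdSimplex.map f t) := by
  have h := ConcreteCategory.congr_hom ((sSetTopAdj.unit.app X).naturality f.op) x
  refine (congrArg (fun y => TopCat.toSSetObjEquiv _ _ y t) h).trans ?_
  rfl

section

variable {X : SSet.{w}} {Y : Type w} [TopologicalSpace Y]

/-- A continuous map out of a geometric realization, given by a compatible family of maps on the
topological simplices. -/
noncomputable def toTopDesc
    (φ : ∀ n : ℕ, X.obj (op ⦋n⦌) → C(stdSimplex ℝ (Fin (n + 1)), Y))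
    (hφ : ∀ (m n : ℕ) (f : (⦋m⦌ : SimplexCategory) ⟶ ⦋n⦌) (x : X.obj (op ⦋n⦌))
      (t : stdSimplex ℝ (Fin (m + 1))), φ m (X.map f.op x) t = φ n x (stdSimplex.map f t)) :
    C(SSet.toTop.obj X, Y) :=
  ((sSetTopAdj.homEquiv X (TopCat.of Y)).symm
    { app n := ↾fun x => (TopCat.toSSetObjEquiv (TopCat.of Y) n).symm (φ n.unop.len x)
      naturality m n f := by
        ext x
        refine (TopCat.toSSetObjEquiv (TopCat.of Y) _).injective ?_
        ext t
        exact hφ _ _ f.unop x t }).hom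

theorem toTopDesc_cell {φ : ∀ n : ℕ, X.obj (op ⦋n⦌) → C(stdSimplex ℝ (Fin (n + 1)), Y)}
    (hφ) {n : ℕ} (x : X.obj (op ⦋n⦌)) (t : stdSimplex ℝ (Fin (n + 1))) :
    toTopDesc φ hφ (cell x t) = φ n x t := by
  have h := (sSetTopAdj.homEquiv X (TopCat.of Y)).apply_symm_apply
    { app n := ↾fun x => (TopCat.toSSetObjEquiv (TopCat.of Y) n).symm (φ n.unop.len x)
      naturality m n f := by
        ext x
        refine (TopCat.toSSetObjEquiv (TopCat.of Y) _).injective ?_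
        ext t
        exact hφ _ _ f.unop x t }
  rw [Adjunction.homEquiv_unit] at h
  have h' := ConcreteCategory.congr_hom (NatTrans.congr_app h (op ⦋n⦌)) x
  exact congrArg (fun y => TopCat.toSSetObjEquiv (TopCat.of Y) (op ⦋n⦌) y t) h'

/-- Continuous maps out of a geometric realization which agree on all simplices are equal. -/
theorem toTop_hom_ext {f g : C(SSet.toTop.obj X, Y)}
    (h : ∀ (n : ℕ) (x : X.obj (op ⦋n⦌)) (t), f (cell x t) = g (cell x t)) : f = g := by
  suffices TopCat.ofHom f = TopCat.ofHom g from congrArg TopCat.Hom.hom this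
  refine (sSetTopAdj.homEquiv X (TopCat.of Y)).injective ?_
  rw [Adjunction.homEquiv_unit, Adjunction.homEquiv_unit]
  ext n x
  refine (TopCat.toSSetObjEquiv (TopCat.of Y) _).injective ?_
  ext t
  exact h _ x t

end

end Realization

/-! ### Supports of points of a simplex -/

namespace stdSimplex

theorem exists_ne_zero_of_map_ne_zero {α β : Type*} [Fintype α] [Fintype β] (f : α → β)
    {t : stdSimplex ℝ α} {b : β} (h : stdSimplex.map f t b ≠ 0) : ∃ a, f a = b ∧ t a ≠ 0 := by
  classical
  rw [stdSimplex.map_coe, FunOnFinite.linearMap_apply_apply] at h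
  obtain ⟨a, ha, h'⟩ := Finset.exists_ne_zero_of_sum_ne_zero h
  exact ⟨a, by simpa using ha, h'⟩

theorem sum_ite_map {α β : Type*} [Fintype α] [Fintype β] (f : α → β) (p : β → Prop)
    [DecidablePred p] (t : stdSimplex ℝ α) :
    (∑ b, if p b then stdSimplex.map f t b else 0) = ∑ a, if p (f a) then t a else 0 := by
  classical
  simp only [stdSimplex.map_coe, FunOnFinite.linearMap_apply_apply]
  rw [← Finset.sum_fiberwise Finset.univ f]
  refine Finset.sum_congr rfl fun y _ => ?_
  split_ifs with h
  · refine Finset.sum_congr rfl fun i hi => ?_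
    rw [(Finset.mem_filter.mp hi).2, if_pos h]
  · refine (Finset.sum_eq_zero fun i hi => ?_).symm
    rw [(Finset.mem_filter.mp hi).2, if_neg h]

theorem map_apply_injective {α β : Type*} [Fintype α] [Fintype β] {f : α → β}
    (hf : Function.Injective f) (t : stdSimplex ℝ α) (a : α) : stdSimplex.map f t (f a) = t a := by
  classical
  rw [stdSimplex.map_coe, FunOnFinite.linearMap_apply_apply]
  exact Finset.sum_eq_single_of_mem a (by simp) fun b hb hba =>
    absurd (hf (by simpa using hb)) hba

theorem map_injective {α β : Type*} [Fintype α] [Fintype β] {f : α → β}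
    (hf : Function.Injective f) : Function.Injective (stdSimplex.map (S := ℝ) f) := by
  intro s t h
  ext a
  rw [← stdSimplex.map_apply_injective hf s, h, stdSimplex.map_apply_injective hf]

/-- A point of the simplex on `β` whose support lies in the image of an injective map `f : α → β`
comes from the face `α`. -/
theorem exists_map_eq {α β : Type*} [Fintype α] [Fintype β] {f : α → β}
    (hf : Function.Injective f) (t : stdSimplex ℝ β) (h : ∀ b, t b ≠ 0 → b ∈ Set.range f) :
    ∃ s : stdSimplex ℝ α, stdSimplex.map f s = t := by
  classical
  have hs : ∑ a, t (f a) = 1 := by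
    rw [← stdSimplex.sum_eq_one t, ← Finset.sum_image (f := t) (g := f) (s := Finset.univ)
      (fun _ _ _ _ e => hf e)]
    refine Finset.sum_subset (Finset.subset_univ _) fun b _ hb => ?_
    by_contra hb'
    obtain ⟨a, rfl⟩ := h b hb'
    exact hb (Finset.mem_image_of_mem f (Finset.mem_univ a))
  refine ⟨⟨fun a => t (f a), fun a => t.2.1 _, hs⟩, ?_⟩
  ext b
  by_cases hb : b ∈ Set.range f
  · obtain ⟨a, rfl⟩ := hb
    exact stdSimplex.map_apply_injective hf _ a
  · have h1 : t b = 0 := by_contra fun h' => hb (h b h')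
    rw [h1]
    by_contra h'
    obtain ⟨a, ha, -⟩ := exists_ne_zero_of_map_ne_zero f h'
    exact hb ⟨a, ha⟩

theorem support_nonempty {α : Type*} [Fintype α] (t : stdSimplex ℝ α)
    [DecidablePred fun a => t a ≠ 0] : (Finset.univ.filter fun a => t a ≠ 0).Nonempty := by
  by_contra h
  rw [Finset.not_nonempty_iff_eq_empty, Finset.filter_eq_empty_iff] at h
  have h1 := stdSimplex.sum_eq_one t
  rw [Finset.sum_eq_zero fun a ha => not_not.mp (h ha)] at h1
  exact zero_ne_one h1

end stdSimplex

/-! ### The order complex of a finite partially ordered set -/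

/-- The geometric realization of the order complex of a finite preorder, in barycentric coordinates:
the points of the simplex spanned by the elements whose support is a chain. -/
def OrderComplex (D : Type*) [Fintype D] [Preorder D] : Type _ :=
  {w : stdSimplex ℝ D // ∀ a b, w a ≠ 0 → w b ≠ 0 → a ≤ b ∨ b ≤ a}

namespace OrderComplex

section

variable {D E : Type*} [Fintype D] [Preorder D] [Fintype E] [Preorder E]

instance : TopologicalSpace (OrderComplex D) :=
  instTopologicalSpaceSubtype

instance : T2Space (OrderComplex D) :=
  inferInstanceAs (T2Space (Subtype _))

theorem continuous_val : Continuous (Subtype.val : OrderComplex D → stdSimplex ℝ D) :=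
  continuous_subtype_val

theorem continuous_apply (a : D) : Continuous fun w : OrderComplex D => w.1 a :=
  (_root_.continuous_apply a).comp (continuous_subtype_val.comp continuous_val)

instance : CompactSpace (OrderComplex D) := by
  refine isCompact_iff_compactSpace.mp (IsClosed.isCompact ?_)
  have hc (a : D) : Continuous fun w : stdSimplex ℝ D => w a :=
    (_root_.continuous_apply a).comp continuous_subtype_val
  have : {w : stdSimplex ℝ D | ∀ a b, w a ≠ 0 → w b ≠ 0 → a ≤ b ∨ b ≤ a} =
      ⋂ (a : D) (b : D) (_ : ¬ (a ≤ b ∨ b ≤ a)), {w | w a * w b = 0} := by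
    ext w
    simp only [Set.mem_ofPred_eq, Set.mem_iInter, mul_eq_zero]
    refine forall₂_congr fun a b => ?_
    tauto
  change IsClosed {w : stdSimplex ℝ D | ∀ a b, w a ≠ 0 → w b ≠ 0 → a ≤ b ∨ b ≤ a}
  rw [this]
  exact isClosed_iInter fun a => isClosed_iInter fun b => isClosed_iInter fun _ =>
    isClosed_eq ((hc a).mul (hc b)) continuous_const

/-- A monotone map induces a map of order complexes. -/
noncomputable def map (f : D →o E) (w : OrderComplex D) : OrderComplex E :=
  ⟨stdSimplex.map f w.1, fun a b ha hb => by
    obtain ⟨i, rfl, hi⟩ := stdSimplex.exists_ne_zero_of_map_ne_zero f ha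
    obtain ⟨j, rfl, hj⟩ := stdSimplex.exists_ne_zero_of_map_ne_zero f hb
    exact (w.2 i j hi hj).imp (fun h => f.monotone h) (fun h => f.monotone h)⟩

/-- The point with barycentric coordinates `t` of the simplex spanned by a chain `x`. -/
noncomputable def ofChain {n : ℕ} (x : Fin (n + 1) →o D) (t : stdSimplex ℝ (Fin (n + 1))) :
    OrderComplex D :=
  map x ⟨t, fun a b _ _ => le_total a b⟩

theorem map_ofChain {n : ℕ} (f : D →o E) (x : Fin (n + 1) →o D)
    (t : stdSimplex ℝ (Fin (n + 1))) : map f (ofChain x t) = ofChain (f.comp x) t :=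
  Subtype.ext (stdSimplex.map_comp_apply x f t)

theorem ofChain_comp {m n : ℕ} (g : Fin (m + 1) →o Fin (n + 1)) (x : Fin (n + 1) →o D)
    (t : stdSimplex ℝ (Fin (m + 1))) :
    ofChain (x.comp g) t = ofChain x (stdSimplex.map g t) :=
  Subtype.ext (stdSimplex.map_comp_apply g x t).symm

theorem continuous_ofChain {n : ℕ} (x : Fin (n + 1) →o D) : Continuous (ofChain x) :=
  Continuous.subtype_mk (stdSimplex.continuous_map x) _

end

/-- A finite non-empty chain can be enumerated increasingly. -/
theorem exists_enum {D : Type*} [PartialOrder D] (s : Finset D) (hs : s.Nonempty)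
    (hc : ∀ a ∈ s, ∀ b ∈ s, a ≤ b ∨ b ≤ a) :
    ∃ (n : ℕ) (z : Fin (n + 1) →o D), Function.Injective z ∧ Set.range z = s := by
  classical
  let _ : LinearOrder s :=
    { (inferInstance : PartialOrder s) with
      le_total := fun a b => hc a a.2 b b.2
      toDecidableLE := Classical.decRel _ }
  obtain ⟨n, hn⟩ : ∃ n, s.card = n + 1 := ⟨s.card - 1, by have := hs.card_pos; omega⟩
  let e : Fin (n + 1) ≃o s := Fintype.orderIsoFinOfCardEq s (by simpa using hn)
  refine ⟨n, ⟨fun i => (e i : D), fun i j h => e.monotone h⟩,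
    fun i j h => e.injective (Subtype.ext h), ?_⟩
  ext a
  refine ⟨?_, fun ha => ⟨e.symm ⟨a, ha⟩, ?_⟩⟩
  · rintro ⟨i, rfl⟩
    exact (e i).2
  · exact congrArg Subtype.val (e.apply_symm_apply ⟨a, ha⟩)

section

variable {D : Type*} [Fintype D] [PartialOrder D]

/-- Every point of the order complex lies in the interior of the simplex spanned by a strictly
increasing chain, namely its support. -/
theorem exists_eq_ofChain (w : OrderComplex D) :
    ∃ (n : ℕ) (z : Fin (n + 1) →o D) (t : stdSimplex ℝ (Fin (n + 1))),
      Function.Injective z ∧ (Set.range z = {a | w.1 a ≠ 0}) ∧ ofChain z t = w := by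
  classical
  obtain ⟨n, z, hz, hr⟩ := exists_enum (Finset.univ.filter fun a => w.1 a ≠ 0)
    (stdSimplex.support_nonempty w.1) (fun a ha b hb => w.2 a b (by simpa using ha)
      (by simpa using hb))
  have hr' : Set.range z = {a | w.1 a ≠ 0} := by rw [hr]; ext; simp
  obtain ⟨t, ht⟩ := stdSimplex.exists_map_eq hz w.1 fun b hb => by rw [hr']; exact hb
  exact ⟨n, z, t, hz, hr', Subtype.ext ht⟩

end

end OrderComplex

/-! ### Mapping an order complex to the realization of a nerve -/

namespace Realization

open Simplicial Opposite

variable {C : Type u} [Category.{v} C]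

/-- The characteristic map of a simplex of the nerve of a category. -/
noncomputable def nerveCell {n : ℕ} (x : Fin (n + 1) ⥤ C) :
    C(stdSimplex ℝ (Fin (n + 1)), SSet.toTop.obj (nerve C)) :=
  cell (X := nerve C) (n := n) x

theorem nerveCell_comp {m n : ℕ} (g : Fin (m + 1) →o Fin (n + 1)) (x : Fin (n + 1) ⥤ C)
    (t : stdSimplex ℝ (Fin (m + 1))) :
    nerveCell (g.monotone.functor ⋙ x) t = nerveCell x (stdSimplex.map g t) :=
  cell_map (X := nerve C) (SimplexCategory.mkHom g) x t

variable {D : Type*} [Fintype D] [PartialOrder D] (F : D ⥤ C)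

/-- The comparison of an arbitrary representative of a point of the order complex with the one given
by the enumeration `z` of the support of the point. -/
theorem nerveCell_eq_of_ofChain_eq_of_injective {m n : ℕ} {x : Fin (m + 1) →o D}
    {z : Fin (n + 1) →o D} (hz : Function.Injective z) {t u}
    (hr : Set.range z = {a | (OrderComplex.ofChain x t).1 a ≠ 0})
    (h : OrderComplex.ofChain x t = OrderComplex.ofChain z u) :
    nerveCell (x.monotone.functor ⋙ F) t = nerveCell (z.monotone.functor ⋙ F) u := by
  classical
  -- Restrict `x` to the face spanned by the support of `t`; there it factors through `z`.
  obtain ⟨l, ι, hι, hιr⟩ := OrderComplex.exists_enum (Finset.univ.filter fun a => t a ≠ 0)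
    (stdSimplex.support_nonempty t) (fun a _ b _ => le_total a b)
  obtain ⟨t', rfl⟩ := stdSimplex.exists_map_eq hι t fun b hb => by rw [hιr]; simpa using hb
  have hmem (i : Fin (l + 1)) : x (ι i) ∈ Set.range z := by
    rw [hr]
    have hi : stdSimplex.map ι t' (ι i) ≠ 0 := by
      have : ι i ∈ Set.range ι := ⟨i, rfl⟩
      rw [hιr, Finset.mem_coe, Finset.mem_filter] at this
      exact this.2
    have hpos := lt_of_le_of_ne ((stdSimplex.map ι t').2.1 (ι i)) hi.symm
    refine ne_of_gt (lt_of_lt_of_le hpos ?_)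
    change _ ≤ stdSimplex.map x (stdSimplex.map ι t') (x (ι i))
    rw [stdSimplex.map_coe x, FunOnFinite.linearMap_apply_apply]
    exact Finset.single_le_sum (f := fun j => stdSimplex.map ι t' j)
      (fun j _ => (stdSimplex.map ι t').2.1 j) (by simp)
  choose g hg using hmem
  have hle {a b : Fin (n + 1)} (hab : z a ≤ z b) : a ≤ b := by
    by_contra hba
    exact hba (hz (le_antisymm hab (z.monotone (le_of_not_ge hba)))).le
  let g' : Fin (l + 1) →o Fin (n + 1) :=
    ⟨g, fun i j hij => hle (by rw [hg, hg]; exact x.monotone (ι.monotone hij))⟩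
  have e : x.comp ι = z.comp g' := by ext i; exact (hg i).symm
  have hu : u = stdSimplex.map g' t' := by
    rw [← OrderComplex.ofChain_comp, e, OrderComplex.ofChain_comp] at h
    exact (stdSimplex.map_injective hz (congrArg Subtype.val h)).symm
  rw [hu, ← nerveCell_comp, ← nerveCell_comp]
  change nerveCell ((x.comp ι).monotone.functor ⋙ F) t' =
    nerveCell ((z.comp g').monotone.functor ⋙ F) t'
  simp only [e]

/-- The point of the realization of the nerve of `C` with given barycentric coordinates on a chain of
`D` depends only on the corresponding point of the order complex. -/
theorem nerveCell_eq_of_ofChain_eq {m n : ℕ} {x : Fin (m + 1) →o D}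
    {y : Fin (n + 1) →o D} {t u} (h : OrderComplex.ofChain x t = OrderComplex.ofChain y u) :
    nerveCell (x.monotone.functor ⋙ F) t = nerveCell (y.monotone.functor ⋙ F) u := by
  obtain ⟨k, z, v, hz, hr, hv⟩ := (OrderComplex.ofChain x t).exists_eq_ofChain
  rw [nerveCell_eq_of_ofChain_eq_of_injective F hz hr hv.symm,
    nerveCell_eq_of_ofChain_eq_of_injective F hz (h ▸ hr) (h.symm.trans hv.symm)]

variable (D) in
/-- The simplices spanned by the strictly increasing chains, glued to the order complex. -/
noncomputable def chainCover :
    C((Σ i : Σ n : Fin (Fintype.card D), {z : Fin (n.1 + 1) →o D // Function.Injective z},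
      stdSimplex ℝ (Fin (i.1.1 + 1))), OrderComplex D) :=
  ⟨fun p => OrderComplex.ofChain p.1.2.1 p.2,
    continuous_sigma fun i => OrderComplex.continuous_ofChain i.2.1⟩

/-- The order complex carries the quotient topology, by compactness. -/
theorem isQuotientMap_chainCover : Topology.IsQuotientMap (chainCover D) := by
  have (n : Fin (Fintype.card D)) : Finite (Fin (n.1 + 1) →o D) :=
    Finite.of_injective (fun f : Fin (n.1 + 1) →o D => (f : Fin (n.1 + 1) → D))
      DFunLike.coe_injective
  refine (chainCover D).continuous.isClosedMap.isQuotientMap (chainCover D).continuous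
    fun w => ?_
  obtain ⟨n, z, t, hz, -, rfl⟩ := w.exists_eq_ofChain
  refine ⟨⟨⟨⟨n, ?_⟩, ⟨z, hz⟩⟩, t⟩, rfl⟩
  have := Fintype.card_le_of_injective z hz
  rw [Fintype.card_fin] at this
  omega

/-- The characteristic maps of the images under `F` of the strictly increasing chains of `D`. -/
noncomputable def chainCells :
    C((Σ i : Σ n : Fin (Fintype.card D), {z : Fin (n.1 + 1) →o D // Function.Injective z},
      stdSimplex ℝ (Fin (i.1.1 + 1))), SSet.toTop.obj (nerve C)) :=
  ⟨fun p => nerveCell (p.1.2.1.monotone.functor ⋙ F) p.2,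
    continuous_sigma fun i => (nerveCell (i.2.1.monotone.functor ⋙ F)).continuous⟩

theorem chainCells_eq (p q) (h : chainCover D p = chainCover D q) :
    chainCells F p = chainCells F q :=
  nerveCell_eq_of_ofChain_eq F h

/-- The map from the order complex of `D` to the realization of the nerve of `C` induced by a
functor `F : D ⥤ C`. -/
noncomputable def realize : C(OrderComplex D, SSet.toTop.obj (nerve C)) :=
  isQuotientMap_chainCover.lift (chainCells F) (chainCells_eq F)

theorem realize_ofChain {n : ℕ} (x : Fin (n + 1) →o D) (t : stdSimplex ℝ (Fin (n + 1))) :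
    realize F (OrderComplex.ofChain x t) = nerveCell (x.monotone.functor ⋙ F) t := by
  obtain ⟨p, hp⟩ := isQuotientMap_chainCover.surjective (OrderComplex.ofChain x t)
  rw [← hp]
  refine (ContinuousMap.congr_fun (isQuotientMap_chainCover.lift_comp
    (chainCells F) (chainCells_eq F)) p).trans ?_
  exact nerveCell_eq_of_ofChain_eq F hp

theorem realize_map {E : Type*} [Fintype E] [PartialOrder E] (f : E →o D) (w : OrderComplex E) :
    realize F (OrderComplex.map f w) = realize (f.monotone.functor ⋙ F) w := by
  obtain ⟨n, z, t, -, -, rfl⟩ := w.exists_eq_ofChain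
  rw [OrderComplex.map_ofChain, realize_ofChain, realize_ofChain]
  rfl

end Realization

/-! ### The prism decomposition of a simplex times an interval -/

/-- The sum of the first `a` entries of `t`. -/
def initialSum {n : ℕ} (t : Fin n → ℝ) (a : ℕ) : ℝ := ∑ i, if i.val < a then t i else 0

theorem initialSum_zero {n : ℕ} (t : Fin n → ℝ) : initialSum t 0 = 0 := by
  simp [initialSum]

theorem initialSum_of_le {n : ℕ} (t : Fin n → ℝ) {a : ℕ} (h : n ≤ a) :
    initialSum t a = ∑ i, t i :=
  Finset.sum_congr rfl fun i _ => if_pos (lt_of_lt_of_le i.2 h)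

theorem initialSum_succ_sub {n : ℕ} (t : Fin n → ℝ) (i : Fin n) :
    initialSum t (i + 1) - initialSum t i = t i := by
  rw [initialSum, initialSum, ← Finset.sum_sub_distrib]
  rw [Finset.sum_eq_single_of_mem i (Finset.mem_univ i)]
  · simp
  · intro j _ hj
    have := Fin.val_ne_of_ne hj
    by_cases h : j.val < i.val
    · rw [if_pos (by omega), if_pos h, sub_self]
    · rw [if_neg (by omega), if_neg h, sub_self]

theorem initialSum_mono {n : ℕ} {t : Fin n → ℝ} (ht : ∀ i, 0 ≤ t i) : Monotone (initialSum t) := by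
  intro a b hab
  refine Finset.sum_le_sum fun i _ => ?_
  split_ifs with h1 h2
  · exact le_rfl
  · omega
  · exact ht i
  · exact le_rfl

/-- Telescoping sums over an initial segment. -/
theorem initialSum_succ_sub_eq {n a : ℕ} (g : ℕ → ℝ) (h : a ≤ n) :
    initialSum (fun i : Fin n => g (i + 1) - g i) a = g a - g 0 := by
  rw [initialSum, Fin.sum_univ_eq_sum_range (fun i => if i < a then g (i + 1) - g i else 0) n,
    ← Finset.sum_filter, ← Finset.sum_range_sub]
  refine Finset.sum_congr ?_ fun _ _ => rfl
  ext i
  simp only [Finset.mem_filter, Finset.mem_range]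
  omega

/-- The preimage of an initial segment under a monotone map is an initial segment. -/
theorem Monotone.exists_val_lt_iff {m n : ℕ} {f : Fin m → Fin n} (hf : Monotone f) (c : ℕ) :
    ∃ a ≤ m, ∀ i, (f i).val < c ↔ i.val < a := by
  by_cases h : ∃ i, ¬ (f i).val < c
  · classical
    obtain ⟨i₀, hi₀⟩ := h
    have hex : ∃ a : ℕ, ∃ ha : a < m, ¬ (f ⟨a, ha⟩).val < c := ⟨i₀.val, i₀.2, hi₀⟩
    obtain ⟨ha, h1⟩ := Nat.find_spec hex
    refine ⟨Nat.find hex, ha.le, fun i => ⟨fun hi => ?_, fun hi => ?_⟩⟩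
    · by_contra h2
      have : f ⟨Nat.find hex, ha⟩ ≤ f i := hf (not_lt.mp h2)
      exact h1 (lt_of_le_of_lt this hi)
    · by_contra h2
      exact Nat.find_min hex hi ⟨i.2, h2⟩
  · push Not at h
    exact ⟨m, le_rfl, fun i => ⟨fun _ => i.2, fun _ => h i⟩⟩

theorem initialSum_map {m n : ℕ} (f : Fin m → Fin n) (t : stdSimplex ℝ (Fin m)) (c : ℕ) :
    initialSum (stdSimplex.map f t) c = ∑ i, if (f i).val < c then t i else 0 :=
  stdSimplex.sum_ite_map f (fun y => y.val < c) t

/-- Increments of a function along the partial sums of barycentric coordinates are compatible with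
the simplicial structure maps. -/
theorem sum_fiber_initialSum {m n : ℕ} {f : Fin m → Fin n} (hf : Monotone f)
    (t : stdSimplex ℝ (Fin m)) (g : ℝ → ℝ) (y : Fin n) :
    (∑ i with f i = y, (g (initialSum t (i + 1)) - g (initialSum t i))) =
      g (initialSum (stdSimplex.map f t) (y + 1)) - g (initialSum (stdSimplex.map f t) y) := by
  -- It suffices to sum over the preimages of initial segments, where the sums telescope.
  have key (c : ℕ) : (∑ i, if (f i).val < c then
      g (initialSum t (i + 1)) - g (initialSum t i) else 0) =
      g (initialSum (stdSimplex.map f t) c) - g 0 := by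
    obtain ⟨a, ha, h⟩ := hf.exists_val_lt_iff c
    rw [initialSum_map]
    simp only [h]
    refine (initialSum_succ_sub_eq (fun i => g (initialSum t i)) ha).trans ?_
    rw [initialSum_zero]
    rfl
  rw [← sub_sub_sub_cancel_right _ _ (g 0), ← key, ← key, ← Finset.sum_sub_distrib,
    Finset.sum_filter]
  refine Finset.sum_congr rfl fun i _ => ?_
  rcases lt_trichotomy (f i) y with h | h | h
  · have := Fin.lt_def.mp h
    rw [if_neg h.ne, if_pos (by omega), if_pos (by omega), sub_self]
  · rw [if_pos h, h, if_pos (by omega), if_neg (by omega), sub_zero]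
  · have := Fin.lt_def.mp h
    rw [if_neg h.ne', if_neg (by omega), if_neg (by omega), sub_self]

/-- Truncation of a real number at `s` from above (`false`) or from below (`true`). -/
def truncate (s : ℝ) (b : Bool) (r : ℝ) : ℝ := bif b then max r s else min r s

theorem truncate_mono (s : ℝ) (b : Bool) : Monotone (truncate s b) := by
  intro x y h
  cases b
  · exact min_le_min_right s h
  · exact max_le_max_right s h

theorem truncate_add (s r : ℝ) : truncate s true r + truncate s false r = r + s :=
  (add_comm _ _).trans (min_add_max r s)

/-- Subdivide `[0, 1]` into consecutive intervals of lengths `t i`. The coordinates of the point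
`(t, s)` of the prism `Δⁿ × [0, 1]` are the lengths of the parts of these intervals to the left
and to the right of `s`. -/
def prismWeight {n : ℕ} (t : Fin n → ℝ) (s : ℝ) (p : Fin n × Bool) : ℝ :=
  truncate s p.2 (initialSum t (p.1 + 1)) - truncate s p.2 (initialSum t p.1)

theorem prismWeight_mem {n : ℕ} (t : stdSimplex ℝ (Fin n)) (s : ℝ) :
    prismWeight t s ∈ stdSimplex ℝ (Fin n × Bool) := by
  refine ⟨fun p => sub_nonneg.mpr (truncate_mono s p.2
    (initialSum_mono t.2.1 (Nat.le_succ _))), ?_⟩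
  rw [Fintype.sum_prod_type, ← stdSimplex.sum_eq_one t]
  refine Finset.sum_congr rfl fun i _ => ?_
  have h1 := truncate_add s (initialSum t (i + 1))
  have h2 := truncate_add s (initialSum t i)
  have h3 := initialSum_succ_sub t i
  rw [Fintype.sum_bool, prismWeight, prismWeight]
  linarith

/-- An interval which meets the left of `s` does not lie beyond one which meets the right of `s`. -/
theorem prismWeight_chain {n : ℕ} (t : stdSimplex ℝ (Fin n)) (s : ℝ) (a b : Fin n × Bool)
    (ha : prismWeight t s a ≠ 0) (hb : prismWeight t s b ≠ 0) : a ≤ b ∨ b ≤ a := by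
  have key (i j : Fin n) (hi : prismWeight t s (i, false) ≠ 0)
      (hj : prismWeight t s (j, true) ≠ 0) : i ≤ j := by
    by_contra hij
    have hlt : j.val + 1 ≤ i.val := not_le.mp hij
    have h1 : initialSum t i < s := by
      by_contra h
      have h' : s ≤ initialSum t (i + 1) :=
        (not_lt.mp h).trans (initialSum_mono t.2.1 (Nat.le_succ _))
      exact hi (by simp [prismWeight, truncate, min_eq_right h', min_eq_right (not_lt.mp h)])
    have h2 : s < initialSum t (j + 1) := by
      by_contra h
      have h' : initialSum t j ≤ s :=
        (initialSum_mono t.2.1 (Nat.le_succ _)).trans (not_lt.mp h)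
      exact hj (by simp [prismWeight, truncate, max_eq_right h', max_eq_right (not_lt.mp h)])
    exact absurd (h1.trans h2) (not_lt.mpr (initialSum_mono t.2.1 hlt))
  obtain ⟨i, b₁⟩ := a
  obtain ⟨j, b₂⟩ := b
  cases b₁ <;> cases b₂
  · exact (le_total i j).imp (fun h => ⟨h, le_rfl⟩) (fun h => ⟨h, le_rfl⟩)
  · exact Or.inl ⟨key i j ha hb, Bool.false_le _⟩
  · exact Or.inr ⟨key j i hb ha, Bool.false_le _⟩
  · exact (le_total i j).imp (fun h => ⟨h, le_rfl⟩) (fun h => ⟨h, le_rfl⟩)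

/-- The map from `Δⁿ × [0, 1]` to the order complex of `[n] × [1]` given by the prism
decomposition. -/
def prism (n : ℕ) : C(stdSimplex ℝ (Fin (n + 1)) × unitInterval,
    OrderComplex (Fin (n + 1) × Bool)) where
  toFun p := ⟨⟨prismWeight p.1 p.2, prismWeight_mem p.1 p.2⟩, prismWeight_chain p.1 p.2⟩
  continuous_toFun := by
    refine Continuous.subtype_mk (Continuous.subtype_mk (continuous_pi fun q => ?_) _) _
    have hs (a : ℕ) : Continuous fun p : stdSimplex ℝ (Fin (n + 1)) × unitInterval =>
        initialSum p.1 a := by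
      refine continuous_finsetSum _ fun i _ => ?_
      split_ifs
      · exact (continuous_apply i).comp (continuous_subtype_val.comp continuous_fst)
      · exact continuous_const
    have ht (a : ℕ) (b : Bool) : Continuous fun p : stdSimplex ℝ (Fin (n + 1)) × unitInterval =>
        truncate p.2 b (initialSum p.1 a) := by
      cases b
      · exact (hs a).min (continuous_subtype_val.comp continuous_snd)
      · exact (hs a).max (continuous_subtype_val.comp continuous_snd)
    exact (ht _ _).sub (ht _ _)

/-- The product of a monotone map with the identity of `{0 < 1}`. -/
def prodBool {m n : ℕ} (f : Fin m →o Fin n) : Fin m × Bool →o Fin n × Bool :=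
  ⟨fun p => (f p.1, p.2), fun _ _ h => ⟨f.monotone h.1, h.2⟩⟩

/-- The inclusion of one end of the prism. -/
def prodBoolMk (n : ℕ) (b : Bool) : Fin n →o Fin n × Bool :=
  ⟨fun i => (i, b), fun _ _ h => ⟨h, le_rfl⟩⟩

/-- The prism decomposition is compatible with the simplicial structure maps. -/
theorem map_prodBool_prism {m n : ℕ} (f : Fin (m + 1) →o Fin (n + 1))
    (t : stdSimplex ℝ (Fin (m + 1))) (s : unitInterval) :
    OrderComplex.map (prodBool f) (prism m (t, s)) = prism n (stdSimplex.map f t, s) := by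
  classical
  refine Subtype.ext (Subtype.ext (funext ?_))
  rintro ⟨y, b⟩
  refine Eq.trans ?_ (sum_fiber_initialSum f.monotone t (truncate s b) y)
  change FunOnFinite.linearMap ℝ ℝ (prodBool f) (prismWeight t s) (y, b) = _
  rw [FunOnFinite.linearMap_apply_apply, Finset.sum_filter, Finset.sum_filter,
    Fintype.sum_prod_type]
  refine Finset.sum_congr rfl fun i _ => ?_
  rw [Fintype.sum_bool]
  have h (c : Bool) : prodBool f (i, c) = (f i, c) := rfl
  cases b <;> simp [h, prismWeight]

theorem eq_map_of_apply_eq_zero {n : ℕ} (b : Bool) (t : stdSimplex ℝ (Fin (n + 1)))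
    (w : OrderComplex (Fin (n + 1) × Bool)) (h : ∀ i, w.1 (i, !b) = 0)
    (h' : ∀ i, w.1 (i, b) = t i) : w = OrderComplex.ofChain (prodBoolMk (n + 1) b) t := by
  refine Subtype.ext (stdSimplex.ext (funext ?_))
  rintro ⟨i, c⟩
  have hinj : Function.Injective (prodBoolMk (n + 1) b) := fun i j e => congrArg Prod.fst e
  by_cases hc : c = b
  · subst hc
    exact (h' i).trans (stdSimplex.map_apply_injective hinj t i).symm
  · obtain rfl : c = !b := by cases b <;> cases c <;> simp_all
    rw [h i]
    by_contra hne
    obtain ⟨j, hj, -⟩ := stdSimplex.exists_ne_zero_of_map_ne_zero _ (Ne.symm hne)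
    exact hc (congrArg Prod.snd hj).symm

theorem initialSum_mem_Icc {n : ℕ} (t : stdSimplex ℝ (Fin n)) (a : ℕ) :
    0 ≤ initialSum t a ∧ initialSum t a ≤ 1 := by
  refine ⟨Finset.sum_nonneg fun i _ => ?_, ?_⟩
  · split_ifs
    · exact t.2.1 i
    · exact le_rfl
  · rw [← stdSimplex.sum_eq_one t, ← initialSum_of_le t (le_max_right a n)]
    exact initialSum_mono t.2.1 (le_max_left a n)

theorem prism_zero {n : ℕ} (t : stdSimplex ℝ (Fin (n + 1))) :
    prism n (t, 0) = OrderComplex.ofChain (prodBoolMk (n + 1) true) t := by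
  refine eq_map_of_apply_eq_zero true t _ (fun i => ?_) fun i => ?_
  · change min _ (0 : ℝ) - min _ (0 : ℝ) = 0
    rw [min_eq_right (initialSum_mem_Icc t _).1, min_eq_right (initialSum_mem_Icc t _).1, sub_self]
  · change max _ (0 : ℝ) - max _ (0 : ℝ) = _
    rw [max_eq_left (initialSum_mem_Icc t _).1, max_eq_left (initialSum_mem_Icc t _).1]
    exact initialSum_succ_sub t i

theorem prism_one {n : ℕ} (t : stdSimplex ℝ (Fin (n + 1))) :
    prism n (t, 1) = OrderComplex.ofChain (prodBoolMk (n + 1) false) t := by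
  refine eq_map_of_apply_eq_zero false t _ (fun i => ?_) fun i => ?_
  · change max _ (1 : ℝ) - max _ (1 : ℝ) = 0
    rw [max_eq_right (initialSum_mem_Icc t _).2, max_eq_right (initialSum_mem_Icc t _).2, sub_self]
  · change min _ (1 : ℝ) - min _ (1 : ℝ) = _
    rw [min_eq_left (initialSum_mem_Icc t _).2, min_eq_left (initialSum_mem_Icc t _).2]
    exact initialSum_succ_sub t i

/-! ### The realization of the nerve of a category equivalent to a finite poset -/

namespace Realization

open Simplicial Opposite

variable {C : Type u} [Category.{v} C]

section

variable [Quiver.IsThin C]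

/-- A functor to a thin category is determined by a monotone family of objects. -/
noncomputable def thinFunctor {D : Type*} [Preorder D] (F : D → C)
    (hF : ∀ a b, a ≤ b → Nonempty (F a ⟶ F b)) : D ⥤ C where
  obj := F
  map f := (hF _ _ (leOfHom f)).some
  map_id _ := Subsingleton.elim _ _
  map_comp _ _ := Subsingleton.elim _ _

theorem thinFunctor_ext {D : Type*} [Preorder D] {F G : D ⥤ C} (h : ∀ a, F.obj a = G.obj a) :
    F = G :=
  CategoryTheory.Functor.ext h fun _ _ _ => Subsingleton.elim _ _

variable {G : C ⥤ C} (η : 𝟭 C ⟶ G)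

/-- The functor `[n] × [1] ⥤ C` which restricts to `x` on `[n] × {0}` and to `x ⋙ G` on
`[n] × {1}`, given by a natural transformation `η : 𝟭 C ⟶ G`. -/
noncomputable def prismFunctor {n : ℕ} (x : Fin n ⥤ C) :
    -- the category of the product preorder, not the product category
    @Functor (Fin n × Bool) (Preorder.smallCategory _) C _ :=
  thinFunctor (fun p : Fin n × Bool => bif p.2 then G.obj (x.obj p.1) else x.obj p.1) <| by
    rintro ⟨i, b⟩ ⟨j, c⟩ ⟨h, hbc⟩
    have f : x.obj i ⟶ x.obj j := x.map (homOfLE h)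
    cases b <;> cases c
    · exact ⟨f⟩
    · exact ⟨f ≫ η.app _⟩
    · exact absurd hbc (by simp)
    · exact ⟨G.map f⟩

/-- A natural transformation from the identity to `G` induces a homotopy from the map given by
`G` on the realization of the nerve to the identity. It is encoded as a map to the space of paths,
so that it can be defined on one simplex at a time. -/
noncomputable def prismHomotopy :
    C(SSet.toTop.obj (nerve C), C(unitInterval, SSet.toTop.obj (nerve C))) :=
  toTopDesc (fun n x => ((realize (prismFunctor η (n := n + 1) x)).comp (prism n)).curry) <| by
    intro m n f x t
    ext s
    refine Eq.trans ?_ (congrArg (realize (prismFunctor η (n := n + 1) x))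
      (map_prodBool_prism f.toOrderHom t s))
    rw [realize_map]
    refine congrArg (fun F => realize F (prism m (t, s))) (thinFunctor_ext ?_)
    rintro ⟨i, b⟩
    rfl

theorem prismHomotopy_zero {n : ℕ} (x : Fin (n + 1) ⥤ C) (t : stdSimplex ℝ (Fin (n + 1))) :
    prismHomotopy η (nerveCell x t) 0 = nerveCell (x ⋙ G) t := by
  refine (ContinuousMap.congr_fun (toTopDesc_cell _ (X := nerve C) (n := n) x t) 0).trans ?_
  refine (congrArg (realize (prismFunctor η x)) (prism_zero t)).trans ?_
  rw [realize_ofChain]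
  exact congrArg (fun F => nerveCell F t) (thinFunctor_ext fun i => rfl)

theorem prismHomotopy_one {n : ℕ} (x : Fin (n + 1) ⥤ C) (t : stdSimplex ℝ (Fin (n + 1))) :
    prismHomotopy η (nerveCell x t) 1 = nerveCell x t := by
  refine (ContinuousMap.congr_fun (toTopDesc_cell _ (X := nerve C) (n := n) x t) 1).trans ?_
  refine (congrArg (realize (prismFunctor η x)) (prism_one t)).trans ?_
  rw [realize_ofChain]
  exact congrArg (fun F => nerveCell F t) (thinFunctor_ext fun i => rfl)

end

variable {D : Type} [Fintype D] [PartialOrder D]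

/-- The image in `D` of a chain of morphisms of `C`. -/
def chainOfFunctor (F : C ⥤ D) {n : ℕ} (x : Fin n ⥤ C) : Fin n →o D :=
  ⟨fun i => F.obj (x.obj i), (x ⋙ F).monotone⟩

/-- The map from the realization of the nerve of `C` to the order complex of `D` induced by a
functor `F : C ⥤ D`. The order complex is lifted to the universe of the realization. -/
noncomputable def toOrderComplex (F : C ⥤ D) :
    C(SSet.toTop.obj (nerve C), ULift.{max u v} (OrderComplex D)) :=
  toTopDesc (fun n x => ⟨fun t => ⟨OrderComplex.ofChain (chainOfFunctor (n := n + 1) F x) t⟩,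
      continuous_uliftUp.comp (OrderComplex.continuous_ofChain _)⟩)
    fun _ n f x t => congrArg ULift.up
      (OrderComplex.ofChain_comp f.toOrderHom (chainOfFunctor (n := n + 1) F x) t)

theorem toOrderComplex_nerveCell (F : C ⥤ D) {n : ℕ} (x : Fin (n + 1) ⥤ C) (t) :
    toOrderComplex F (nerveCell x t) =
      ⟨OrderComplex.ofChain (chainOfFunctor F x) t⟩ :=
  toTopDesc_cell _ (X := nerve C) (n := n) x t

/-- The realization of the nerve of a category equivalent to a finite poset is homotopy equivalent
to the order complex of the poset. -/
theorem nonempty_homotopyEquiv_orderComplex (e : C ≌ D) :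
    Nonempty (ContinuousMap.HomotopyEquiv (SSet.toTop.obj (nerve C)) (OrderComplex D)) := by
  have : Quiver.IsThin C := fun _ _ => ⟨fun f g => e.functor.map_injective (Subsingleton.elim _ _)⟩
  let f : C(SSet.toTop.obj (nerve C), OrderComplex D) :=
    ContinuousMap.comp ⟨ULift.down, continuous_uliftDown⟩ (toOrderComplex e.functor)
  let g : C(OrderComplex D, SSet.toTop.obj (nerve C)) := realize e.inverse
  have hf {n : ℕ} (x : Fin (n + 1) ⥤ C) (t) : f (nerveCell x t) =
      OrderComplex.ofChain (chainOfFunctor e.functor x) t :=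
    congrArg ULift.down (toOrderComplex_nerveCell e.functor x t)
  refine ⟨⟨f, g, ⟨⟨(prismHomotopy e.unit).uncurry.comp
    ⟨Prod.swap, continuous_swap⟩, fun y => ?_, fun y => ?_⟩⟩, ?_⟩⟩
  · refine ContinuousMap.congr_fun
      (f := (⟨fun φ => φ 0, by fun_prop⟩ : C(C(unitInterval, _), _)).comp
        (prismHomotopy e.unit)) (g := g.comp f) (toTop_hom_ext fun n x t => ?_) y
    refine (prismHomotopy_zero e.unit (n := n) x t).trans ?_
    exact ((congrArg g (hf (n := n) x t)).trans (realize_ofChain e.inverse _ t)).symm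
  · refine ContinuousMap.congr_fun
      (f := (⟨fun φ => φ 1, by fun_prop⟩ : C(C(unitInterval, _), _)).comp
        (prismHomotopy e.unit)) (g := ContinuousMap.id _) (toTop_hom_ext fun n x t => ?_) y
    exact prismHomotopy_one e.unit (n := n) x t
  · have : f.comp g = ContinuousMap.id _ := by
      ext1 w
      obtain ⟨n, z, t, -, -, rfl⟩ := w.exists_eq_ofChain
      change f (realize e.inverse _) = _
      rw [realize_ofChain, hf]
      refine congrArg (fun z => OrderComplex.ofChain z t) (OrderHom.ext _ _ (funext fun i => ?_))
      -- Isomorphic elements of a poset are equal.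
      exact (e.counitIso.app (z i)).to_eq
    rw [this]

end Realization

/-! ### The order complex of the proper non-empty subsets is a sphere -/

/-- The poset of non-empty proper subsets of `ι`. -/
abbrev ProperSubset (ι : Type*) : Type _ := {s : Set ι // s.Nonempty ∧ s ≠ Set.univ}

namespace ProperSubset

section

variable {ι : Type*} [Fintype (ProperSubset ι)]

open Classical in
/-- The convex combination, with coefficients `w`, of the indicator functions of the non-empty proper
subsets of `ι`. -/
noncomputable def height (w : OrderComplex (ProperSubset ι)) (i : ι) : ℝ :=
  ∑ p : ProperSubset ι, if i ∈ p.1 then w.1 p else 0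

theorem height_nonneg (w : OrderComplex (ProperSubset ι)) (i : ι) : 0 ≤ height w i := by
  classical
  refine Finset.sum_nonneg fun p _ => ?_
  split_ifs
  exacts [w.1.2.1 p, le_rfl]

theorem height_le_one (w : OrderComplex (ProperSubset ι)) (i : ι) : height w i ≤ 1 := by
  classical
  rw [← stdSimplex.sum_eq_one w.1]
  refine Finset.sum_le_sum fun p _ => ?_
  split_ifs
  exacts [le_rfl, w.1.2.1 p]

/-- The elements of the smallest set in the support of `w` have height one. -/
theorem exists_height_eq_one (w : OrderComplex (ProperSubset ι)) : ∃ i, height w i = 1 := by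
  classical
  obtain ⟨p, hp⟩ := Finset.exists_minimal (stdSimplex.support_nonempty w.1)
  obtain ⟨i, hi⟩ := p.2.1
  refine ⟨i, ?_⟩
  rw [← stdSimplex.sum_eq_one w.1]
  refine Finset.sum_congr rfl fun q _ => ?_
  split_ifs with h
  · rfl
  · by_contra hq
    have hq' : w.1 q ≠ 0 := fun h' => hq h'.symm
    have hp' : w.1 p ≠ 0 := by simpa using hp.1
    rcases w.2 p q hp' hq' with h1 | h1
    · exact h (h1 hi)
    · exact h (hp.2 (by simpa using hq') h1 hi)

/-- The elements outside the largest set in the support of `w` have height zero. -/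
theorem exists_height_eq_zero (w : OrderComplex (ProperSubset ι)) : ∃ i, height w i = 0 := by
  classical
  obtain ⟨p, hp⟩ := Finset.exists_maximal (stdSimplex.support_nonempty w.1)
  obtain ⟨i, hi⟩ := (Set.ne_univ_iff_exists_notMem _).mp p.2.2
  refine ⟨i, Finset.sum_eq_zero fun q _ => ?_⟩
  split_ifs with h
  · by_contra hq
    have hp' : w.1 p ≠ 0 := by simpa using hp.1
    rcases w.2 p q hp' hq with h1 | h1
    · exact hi (hp.2 (by simpa using hq) h1 h)
    · exact hi (h1 h)
  · rfl

/-- The height drops by at least `w p` on leaving a set `p` of the support. -/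
theorem le_height_sub_height (w : OrderComplex (ProperSubset ι)) {p : ProperSubset ι}
    (hp : w.1 p ≠ 0) {i j : ι} (hi : i ∈ p.1) (hj : j ∉ p.1) :
    w.1 p ≤ height w i - height w j := by
  classical
  rw [height, height, ← Finset.sum_sub_distrib]
  have h0 (q : ProperSubset ι) : 0 ≤ w.1 q := w.1.2.1 q
  refine le_trans ?_ (Finset.single_le_sum (fun q _ => ?_) (Finset.mem_univ p))
  · rw [if_pos hi, if_neg hj, sub_zero]
  · by_cases hq : w.1 q = 0
    · simp [hq]
    · rcases w.2 p q hp hq with h | h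
      · rw [if_pos (h hi)]
        split_ifs
        · exact (sub_self _).ge
        · rw [sub_zero]; exact h0 q
      · rw [if_neg fun h' => hj (h h'), sub_zero]
        split_ifs
        exacts [h0 q, le_rfl]

/-- For every `p`, in the support or not, some pair of points shows a drop of at most `w p`. -/
theorem exists_height_sub_height_le [Finite ι] (w : OrderComplex (ProperSubset ι))
    (p : ProperSubset ι) : ∃ i ∈ p.1, ∃ j ∉ p.1, height w i - height w j ≤ w.1 p := by
  classical
  -- Take the lowest point of `p` and the highest point of its complement.
  obtain ⟨i, hi, hmin⟩ := Set.exists_min_image p.1 (height w) (Set.toFinite _) p.2.1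
  obtain ⟨j, hj, hmax⟩ := Set.exists_max_image p.1ᶜ (height w) (Set.toFinite _)
    (Set.nonempty_compl.mpr p.2.2)
  refine ⟨i, hi, j, hj, ?_⟩
  have h0 (q : ProperSubset ι) : 0 ≤ w.1 q := w.1.2.1 q
  rw [height, height, ← Finset.sum_sub_distrib]
  calc _ ≤ ∑ q, if q = p then w.1 q else 0 := Finset.sum_le_sum fun q _ => ?_
    _ = w.1 p := by simp
  by_cases hq : w.1 q = 0
  · simp [hq]
  by_cases hqp : q = p
  · subst hqp
    rw [if_pos hi, if_neg hj, if_pos rfl, sub_zero]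
  rw [if_neg hqp]
  by_cases hiq : i ∈ q.1
  · by_cases hjq : j ∈ q.1
    · rw [if_pos hiq, if_pos hjq, sub_self]
    · exfalso
      have hpos : 0 < w.1 q := lt_of_le_of_ne (h0 q) (Ne.symm hq)
      refine hqp (Subtype.ext (Set.Subset.antisymm (fun k hk => ?_) fun k hk => ?_))
      · by_contra hkp
        have h1 := le_height_sub_height w hq hk hjq
        have h2 := hmax k hkp
        linarith
      · by_contra hkq
        have h1 := le_height_sub_height w hq hiq hkq
        have h2 := hmin k hk
        linarith
  · rw [if_neg hiq]
    split_ifs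
    · linarith [h0 q]
    · exact (sub_self _).le

/-- A point of the order complex is determined by its height function: the coordinate of a set `p`
in the support is the difference between the lowest height on `p` and the greatest height on the
complement of `p`. -/
theorem height_injective [Finite ι] :
    Function.Injective (height : OrderComplex (ProperSubset ι) → ι → ℝ) := by
  have key (v w : OrderComplex (ProperSubset ι)) (h : height v = height w) (p) :
      v.1 p ≤ w.1 p := by
    by_cases hp : v.1 p = 0
    · rw [hp]; exact w.1.2.1 p
    · obtain ⟨i, hi, j, hj, h'⟩ := exists_height_sub_height_le w p
      rw [← h] at h'
      exact (le_height_sub_height v hp hi hj).trans h'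
  intro v w h
  exact Subtype.ext (stdSimplex.ext (funext fun p => le_antisymm (key v w h p) (key w v h.symm p)))

theorem continuous_height (i : ι) :
    Continuous fun w : OrderComplex (ProperSubset ι) => height w i := by
  classical
  refine continuous_finsetSum _ fun p _ => ?_
  split_ifs
  exacts [OrderComplex.continuous_apply p, continuous_const]

end

/-- Layer cake decomposition: a function with minimum `0` and maximum `1` is a convex combination
of the indicator functions of its superlevel sets. -/
theorem exists_height_eq {d : ℕ} [Fintype (ProperSubset (Fin (d + 1)))] (f : Fin (d + 1) → ℝ)
    (h0 : ∀ i, 0 ≤ f i) (h1 : ∀ i, f i ≤ 1) (h0' : ∃ i, f i = 0) (h1' : ∃ i, f i = 1) :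
    ∃ w : OrderComplex (ProperSubset (Fin (d + 1))), height w = f := by
  classical
  let σ := Tuple.sort f
  have hσ : Monotone (f ∘ σ) := Tuple.monotone_sort f
  have hbot : f (σ 0) = 0 := by
    obtain ⟨i, hi⟩ := h0'
    refine le_antisymm ?_ (h0 _)
    have : f (σ 0) ≤ f (σ (σ.symm i)) := hσ (Fin.zero_le _)
    rwa [Equiv.apply_symm_apply, hi] at this
  have htop : f (σ (Fin.last d)) = 1 := by
    obtain ⟨i, hi⟩ := h1'
    refine le_antisymm (h1 _) ?_
    have : f (σ (σ.symm i)) ≤ f (σ (Fin.last d)) := hσ (Fin.le_last _)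
    rwa [Equiv.apply_symm_apply, hi] at this
  -- The values of `f` in increasing order; the entries beyond `d` play no role.
  let g : ℕ → ℝ := fun a => if h : a < d + 1 then f (σ ⟨a, h⟩) else 0
  have hg {a : ℕ} (h : a < d + 1) : g a = f (σ ⟨a, h⟩) := dif_pos h
  have hg0 : g 0 = 0 := (hg (Nat.succ_pos d)).trans hbot
  have hgd : g d = 1 := (hg (Nat.lt_succ_self d)).trans htop
  have ht : (fun j : Fin d => g (j + 1) - g j) ∈ stdSimplex ℝ (Fin d) := by
    refine ⟨fun j => ?_, ?_⟩
    · have := j.2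
      rw [sub_nonneg, hg (show j.val < d + 1 by omega), hg (show j.val + 1 < d + 1 by omega)]
      exact hσ (Fin.mk_le_mk.mpr (Nat.le_succ _))
    · rw [← initialSum_of_le _ le_rfl, initialSum_succ_sub_eq g le_rfl, hg0, hgd, sub_zero]
  let c : Fin d → ProperSubset (Fin (d + 1)) := fun j =>
    ⟨{i | j.val < (σ.symm i).val}, ⟨σ (Fin.last d), by simp⟩, by
      rw [Set.ne_univ_iff_exists_notMem]
      exact ⟨σ 0, by simp⟩⟩
  have hc {j k : Fin d} (h : j ≤ k) : c k ≤ c j := fun i hi =>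
    show j.val < (σ.symm i).val from lt_of_le_of_lt (Fin.le_def.mp h) hi
  let t : stdSimplex ℝ (Fin d) := ⟨_, ht⟩
  refine ⟨⟨stdSimplex.map c t, fun p q hp hq => ?_⟩, funext fun i => ?_⟩
  · obtain ⟨j, rfl, -⟩ := stdSimplex.exists_ne_zero_of_map_ne_zero _ hp
    obtain ⟨k, rfl, -⟩ := stdSimplex.exists_ne_zero_of_map_ne_zero _ hq
    exact ((le_total j k).imp hc hc).symm
  · have h2 : (σ.symm i).val ≤ d := Nat.lt_succ_iff.mp (σ.symm i).2
    have h3 := initialSum_succ_sub_eq g h2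
    rw [hg0, hg (σ.symm i).2, sub_zero, Fin.eta, Equiv.apply_symm_apply] at h3
    rw [← h3]
    refine (stdSimplex.sum_ite_map c (fun p => i ∈ p.1) t).trans ?_
    refine Finset.sum_congr rfl fun j _ => ?_
    have h4 : i ∈ (c j).1 ↔ j.val < (σ.symm i).val := Iff.rfl
    by_cases h5 : j.val < (σ.symm i).val
    · rw [if_pos h5, if_pos (h4.mpr h5)]
      rfl
    · rw [if_neg h5, if_neg fun h6 => h5 (h4.mp h6)]

variable {d : ℕ}

/-- The linear map `ℝᵈ⁺¹ → ℝᵈ` with kernel the constant functions, given by subtracting the value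
at `0`. -/
def differences (f : Fin (d + 1) → ℝ) : EuclideanSpace ℝ (Fin d) :=
  WithLp.toLp 2 fun i => f i.succ - f 0

theorem sub_eq_of_differences_eq {f g : Fin (d + 1) → ℝ} {c : ℝ}
    (h : differences f = c • differences g) (i j : Fin (d + 1)) : f i - f j = c * (g i - g j) := by
  have key (i : Fin (d + 1)) : f i - f 0 = c * (g i - g 0) := by
    induction i using Fin.cases with
    | zero => simp
    | succ i => exact congrArg (fun v : EuclideanSpace ℝ (Fin d) => v i) h
  linear_combination key i - key j

theorem differences_ne_zero {f : Fin (d + 1) → ℝ} {i j} (h : f i ≠ f j) : differences f ≠ 0 := by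
  intro h'
  have := sub_eq_of_differences_eq (f := f) (g := f) (c := 0) (by rw [h', zero_smul]) i j
  exact h (sub_eq_zero.mp (this.trans (zero_mul _)))

variable [Fintype (ProperSubset (Fin (d + 1)))]

theorem differences_height_ne_zero (w : OrderComplex (ProperSubset (Fin (d + 1)))) :
    differences (height w) ≠ 0 := by
  obtain ⟨i, hi⟩ := exists_height_eq_one w
  obtain ⟨j, hj⟩ := exists_height_eq_zero w
  exact differences_ne_zero (i := i) (j := j) (by rw [hi, hj]; exact one_ne_zero)

/-- The radial projection of the height function to the unit sphere. -/
noncomputable def toSphere (w : OrderComplex (ProperSubset (Fin (d + 1)))) :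
    Metric.sphere (0 : EuclideanSpace ℝ (Fin d)) 1 :=
  ⟨‖differences (height w)‖⁻¹ • differences (height w), by
    rw [mem_sphere_zero_iff_norm, norm_smul, norm_inv, norm_norm,
      inv_mul_cancel₀ (norm_ne_zero_iff.mpr (differences_height_ne_zero w))]⟩

theorem continuous_toSphere :
    Continuous (toSphere : OrderComplex (ProperSubset (Fin (d + 1))) → _) := by
  have h : Continuous fun w : OrderComplex (ProperSubset (Fin (d + 1))) =>
      differences (height w) :=
    (PiLp.continuous_toLp 2 _).comp
      (continuous_pi fun i => (continuous_height i.succ).sub (continuous_height 0))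
  exact ((h.norm.inv₀ fun w => norm_ne_zero_iff.mpr (differences_height_ne_zero w)).smul
    h).subtype_mk _

theorem toSphere_injective :
    Function.Injective (toSphere : OrderComplex (ProperSubset (Fin (d + 1))) → _) := by
  -- Proportional difference vectors are equal, since heights have range exactly `[0, 1]`.
  have key (v w : OrderComplex (ProperSubset (Fin (d + 1)))) (c : ℝ) (hc : 0 < c)
      (h : ∀ i j, height v i - height v j = c * (height w i - height w j)) : 1 ≤ c := by
    obtain ⟨i, hi⟩ := exists_height_eq_one v
    obtain ⟨j, hj⟩ := exists_height_eq_zero v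
    have h' := h i j
    rw [hi, hj, sub_zero] at h'
    nlinarith [height_le_one w i, height_nonneg w j]
  intro v w h
  have hv := norm_pos_iff.mpr (differences_height_ne_zero v)
  have hw := norm_pos_iff.mpr (differences_height_ne_zero w)
  obtain ⟨c, hc, e⟩ : ∃ c : ℝ, 0 < c ∧ differences (height v) = c • differences (height w) := by
    refine ⟨‖differences (height v)‖ * ‖differences (height w)‖⁻¹, by positivity, ?_⟩
    have h' : ‖differences (height v)‖⁻¹ • differences (height v) =
        ‖differences (height w)‖⁻¹ • differences (height w) := congrArg Subtype.val h
    rw [mul_smul, ← h']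
    exact (smul_inv_smul₀ hv.ne' _).symm
  have hvw := sub_eq_of_differences_eq e
  have h1 := key v w c hc hvw
  have h2 := key w v c⁻¹ (by positivity) fun i j => by
    rw [hvw, inv_mul_cancel_left₀ hc.ne']
  have hc1 : c = 1 := le_antisymm ((one_le_inv₀ hc).mp h2) h1
  subst hc1
  refine height_injective (funext fun i => ?_)
  obtain ⟨j, hj⟩ := exists_height_eq_zero v
  obtain ⟨k, hk⟩ := exists_height_eq_zero w
  have h3 := hvw i j
  have h4 := hvw k j
  have h5 := height_nonneg v k
  have h6 := height_nonneg w j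
  linarith

theorem toSphere_surjective :
    Function.Surjective (toSphere : OrderComplex (ProperSubset (Fin (d + 1))) → _) := by
  rintro ⟨v, hv⟩
  rw [mem_sphere_zero_iff_norm] at hv
  let f : Fin (d + 1) → ℝ := Fin.cons 0 v
  obtain ⟨i, hi⟩ := Finite.exists_min f
  obtain ⟨j, hj⟩ := Finite.exists_max f
  have hlt : f i < f j := by
    by_contra h
    have hconst (k : Fin (d + 1)) : f k = 0 := by
      have h0 : f 0 = 0 := rfl
      linarith [hi k, hj k, hi 0, hj 0]
    have : v = 0 := by
      ext k
      exact hconst k.succ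
    rw [this, norm_zero] at hv
    exact zero_ne_one hv
  have hpos : 0 < f j - f i := sub_pos.mpr hlt
  obtain ⟨w, hw⟩ := exists_height_eq (fun k => (f j - f i)⁻¹ * (f k - f i))
    (fun k => mul_nonneg (inv_nonneg.mpr hpos.le) (sub_nonneg.mpr (hi k)))
    (fun k => by
      rw [inv_mul_le_iff₀ hpos, mul_one]
      exact sub_le_sub_right (hj k) _)
    ⟨i, by simp⟩ ⟨j, inv_mul_cancel₀ hpos.ne'⟩
  refine ⟨w, Subtype.ext ?_⟩
  have hd : differences (height w) = (f j - f i)⁻¹ • v := by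
    rw [hw]
    ext k
    change (f j - f i)⁻¹ * (v k - f i) - (f j - f i)⁻¹ * (0 - f i) = (f j - f i)⁻¹ * v k
    ring
  change ‖differences (height w)‖⁻¹ • differences (height w) = v
  rw [hd, norm_smul, hv, mul_one, norm_inv, Real.norm_of_nonneg hpos.le, inv_inv,
    smul_inv_smul₀ hpos.ne']

/-- The order complex of the poset of non-empty proper subsets of `{0, …, d}`, that is, the
barycentric subdivision of the boundary of a `d`-simplex, is a sphere. -/
noncomputable def homeomorphSphere : OrderComplex (ProperSubset (Fin (d + 1))) ≃ₜ
    Metric.sphere (0 : EuclideanSpace ℝ (Fin d)) 1 :=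
  continuous_toSphere.homeoOfEquivCompactToT2
    (f := Equiv.ofBijective toSphere ⟨toSphere_injective, toSphere_surjective⟩)

end ProperSubset

/-- A poset and its opposite have the same order complex. -/
def OrderComplex.orderDual (D : Type*) [Fintype D] [PartialOrder D] :
    OrderComplex Dᵒᵈ ≃ₜ OrderComplex D where
  toFun w := ⟨w.1, fun a b ha hb => (w.2 a b ha hb).symm⟩
  invFun w := ⟨w.1, fun a b ha hb => (w.2 a b ha hb).symm⟩
  left_inv _ := rfl
  right_inv _ := rfl
  continuous_toFun := Continuous.subtype_mk continuous_val _
  continuous_invFun := Continuous.subtype_mk continuous_val _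

/-! ### Factorizations in the associative operad -/

namespace Assoc

variable {X Y Y' Z : Assoc.{u}}

/-- The underlying function of a morphism. -/
abbrev fn (f : X ⟶ Y) (a : X.pt.obj) : Y.pt.obj := FinPtd.map (Hom.map f) a

/-- The base point. -/
abbrev base (X : Assoc.{u}) : X.pt.obj := X.pt.obj.point

/-- A morphism is active if only the base point is sent to the base point. -/
abbrev IsActive (f : X ⟶ Y) : Prop := FinPtd.active (Hom.map f)

theorem fn_base (f : X ⟶ Y) : fn f (base X) = base Y := FinPtd.map_point _

theorem IsActive.fn_ne {f : X ⟶ Y} (hf : IsActive f) {a : X.pt.obj} (ha : a ≠ base X) :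
    fn f a ≠ base Y := fun h => ha (hf a h)

theorem le_of_comp_eq {f : X ⟶ Y} {g : Y ⟶ Z} {μ : X ⟶ Z} (h : f ≫ g = μ) {a b : X.pt.obj}
    (hab : Hom.le μ a b) : Hom.le g (fn f a) (fn f b) := by
  subst h
  exact hab.1

theorem hom_ext {f g : X ⟶ Y} (h : ∀ a, fn f a = fn g a) (h' : ∀ a b, Hom.le f a b ↔ Hom.le g a b) :
    f = g := by
  refine Hom.ext (ObjectProperty.hom_ext _ (Pointed.Hom.ext (funext h))) ?_
  funext a b
  exact propext (h' a b)

/-- The orderings on the fibres of the first factor are restrictions of the orderings of the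
composite, if the second factor is active. -/
theorem le_iff_of_comp_eq {f : X ⟶ Y} {g : Y ⟶ Z} {μ : X ⟶ Z} (h : f ≫ g = μ) (hg : IsActive g)
    (a b : X.pt.obj) :
    Hom.le f a b ↔ fn f a = fn f b ∧ fn f a ≠ base Y ∧ Hom.le μ a b := by
  subst h
  refine ⟨fun hab => ?_, fun ⟨h1, _, h3⟩ => h3.2 h1⟩
  obtain ⟨h1, h2⟩ := Hom.fiber f hab
  refine ⟨h1, h2, ?_, fun _ => hab⟩
  exact h1 ▸ Hom.refl g _ (hg.fn_ne h2)

/-- A first factor, followed by a given active morphism, is determined by its underlying map. -/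
theorem eq_of_comp_eq {f f' : X ⟶ Y} {g : Y ⟶ Z} (hg : IsActive g) (h : f ≫ g = f' ≫ g)
    (hfn : ∀ a, fn f a = fn f' a) : f = f' :=
  hom_ext hfn fun a b => by
    rw [le_iff_of_comp_eq rfl hg, le_iff_of_comp_eq (μ := f ≫ g) h.symm hg, hfn, hfn]

/-- `Z` has at most one element besides the base point. -/
def IsUnary (Z : Assoc.{u}) : Prop := ∀ a b : Z.pt.obj, a ≠ base Z → b ≠ base Z → a = b

theorem total_of_isUnary (hZ : IsUnary Z) {μ : X ⟶ Z} (hμ : IsActive μ) {a b : X.pt.obj}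
    (ha : a ≠ base X) (hb : b ≠ base X) : Hom.le μ a b ∨ Hom.le μ b a :=
  Hom.total μ (hZ _ _ (hμ.fn_ne ha) (hμ.fn_ne hb)) (hμ.fn_ne ha)

theorem ne_base_of_le {f : X ⟶ Y} {a b : X.pt.obj} (h : Hom.le f a b) :
    a ≠ base X ∧ b ≠ base X := by
  obtain ⟨h1, h2⟩ := Hom.fiber f h
  refine ⟨fun e => h2 ?_, fun e => h2 ?_⟩
  · rw [e]; exact fn_base f
  · rw [h1, e]; exact fn_base f

/-- Surjectivity away from the base points. -/
def IsSurj (f : X ⟶ Y) : Prop := ∀ b, b ≠ base Y → ∃ a, fn f a = b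

theorem IsSurj.surjective {f : X ⟶ Y} (hf : IsSurj f) : Function.Surjective (fn f) := by
  intro b
  by_cases hb : b = base Y
  · exact ⟨base X, hb ▸ fn_base f⟩
  · exact hf b hb

/-- A factorization `μ = f ≫ g` maps to a factorization `μ = f' ≫ g'` as soon as the fibres of `f`
are contained in fibres of `f'`. -/
theorem exists_factor (hZ : IsUnary Z) {μ : X ⟶ Z} {f : X ⟶ Y} {g : Y ⟶ Z} {f' : X ⟶ Y'}
    {g' : Y' ⟶ Z} (h : f ≫ g = μ) (h' : f' ≫ g' = μ) (hf : IsActive f) (hg : IsActive g)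
    (hf' : IsActive f') (hg' : IsActive g') (hs : IsSurj f)
    (hff : ∀ a b, fn f a = fn f b → fn f' a = fn f' b) :
    ∃ m : Y ⟶ Y', IsActive m ∧ f ≫ m = f' ∧ m ≫ g' = g := by
  have hμ : IsActive μ := by
    subst h
    exact FinPtd.active.comp_mem _ _ hf hg
  choose r hr using hs.surjective
  have hφ (a : X.pt.obj) : fn f' (r (fn f a)) = fn f' a := hff _ _ (hr _)
  let φ : Y.pt.obj → Y'.pt.obj := fun b => fn f' (r b)
  have hφb : φ (base Y) = base Y' := by
    have := hφ (base X)
    rwa [fn_base, fn_base] at this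
  have hφne {b : Y.pt.obj} (hb : b ≠ base Y) : φ b ≠ base Y' := by
    refine hf'.fn_ne fun e => hb ?_
    rw [← hr b, e, fn_base]
  have hφne' {b : Y.pt.obj} (hb : φ b ≠ base Y') : b ≠ base Y := fun e => hb (e ▸ hφb)
  let m : Y ⟶ Y' :=
    { map := ⟨⟨φ, hφb⟩⟩
      le := fun a b => φ a = φ b ∧ φ a ≠ base Y' ∧ Hom.le g a b
      fiber := fun h => ⟨h.1, h.2.1⟩
      refl := fun a ha => ⟨rfl, ha, Hom.refl g a (hg.fn_ne (hφne' ha))⟩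
      trans := fun h₁ h₂ => ⟨h₁.1.trans h₂.1, h₁.2.1, Hom.trans g h₁.2.2 h₂.2.2⟩
      antisymm := fun h₁ h₂ => Hom.antisymm g h₁.2.2 h₂.2.2
      total := by
        intro a b e ha
        have e' : φ a = φ b := e
        have ha' : φ a ≠ base Y' := ha
        exact (total_of_isUnary hZ hg (hφne' ha') (hφne' (e' ▸ ha'))).imp
          (fun l => ⟨e', ha', l⟩) (fun l => ⟨e'.symm, e' ▸ ha', l⟩) }
  have hm : IsActive m := fun a ha => by_contra fun hne => hφne hne ha
  have hcomp (b : Y.pt.obj) : fn g' (φ b) = fn g b := by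
    have h1 : fn μ (r b) = fn g b := by
      rw [← h]
      exact congrArg (fn g) (hr b)
    rw [← h1, ← h']
    rfl
  -- `φ` is monotone for the orderings of `Y` and `Y'` over `Z`, since both are induced from `X`.
  have hto {a b : Y.pt.obj} (hab : Hom.le g a b) : Hom.le g' (φ a) (φ b) := by
    obtain ⟨ha, hb⟩ := ne_base_of_le hab
    by_cases e : a = b
    · rw [← e]; exact Hom.refl g' _ (hg'.fn_ne (hφne ha))
    · have hra : r a ≠ base X := fun e => ha (by rw [← hr a, e, fn_base])
      have hrb : r b ≠ base X := fun e => hb (by rw [← hr b, e, fn_base])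
      rcases total_of_isUnary hZ hμ hra hrb with l | l
      · exact le_of_comp_eq h' l
      · have l' := le_of_comp_eq h l
        rw [hr, hr] at l'
        exact absurd (Hom.antisymm g hab l') e
  have hmg : m ≫ g' = g := by
    refine hom_ext hcomp fun a b => ⟨fun l => ?_, fun l => ⟨hto l, fun e => ?_⟩⟩
    · obtain ⟨l1, l2⟩ := l
      by_cases e : φ a = φ b
      · exact (l2 e).2.2
      · obtain ⟨ha, hb⟩ := ne_base_of_le l1
        rcases total_of_isUnary hZ hg (hφne' ha) (hφne' hb) with l | l
        · exact l
        · exact absurd (Hom.antisymm g' l1 (hto l)) e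
    · exact ⟨e, hφne (ne_base_of_le l).1, l⟩
  refine ⟨m, hm, eq_of_comp_eq hg' ?_ fun a => hφ a, hmg⟩
  rw [Category.assoc, hmg, h, h']

/-! ### Cut sets -/

/-- An increasing enumeration of the elements of the source of `μ` besides the base point. -/
structure Enumeration (μ : X ⟶ Z) (m : ℕ) where
  elem : Fin m → X.pt.obj
  elem_ne : ∀ i, elem i ≠ base X
  exists_elem : ∀ a, a ≠ base X → ∃ i, elem i = a
  le_iff : ∀ i j, Hom.le μ (elem i) (elem j) ↔ i ≤ j

theorem Enumeration.elem_injective {μ : X ⟶ Z} {m : ℕ} (e : Enumeration μ m) :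
    Function.Injective e.elem := fun i j h =>
  le_antisymm ((e.le_iff i j).mp (h ▸ (e.le_iff i i).mpr le_rfl))
    ((e.le_iff j i).mp (h ▸ (e.le_iff i i).mpr le_rfl))

theorem exists_enumeration (hZ : IsUnary Z) {μ : X ⟶ Z} (hμ : IsActive μ) {m : ℕ}
    (hm : Nat.card X.pt.Unpointed = m) : Nonempty (Enumeration μ m) := by
  classical
  let _ : LinearOrder X.pt.Unpointed :=
    { le := fun a b => Hom.le μ a.1 b.1
      le_refl := fun a => Hom.refl μ _ (hμ.fn_ne a.2)
      le_trans := fun _ _ _ h₁ h₂ => Hom.trans μ h₁ h₂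
      le_antisymm := fun _ _ h₁ h₂ => Subtype.ext (Hom.antisymm μ h₁ h₂)
      le_total := fun a b => total_of_isUnary hZ hμ a.2 b.2
      toDecidableLE := Classical.decRel _ }
  let _ : Fintype X.pt.Unpointed := Fintype.ofFinite _
  let e : Fin m ≃o X.pt.Unpointed :=
    Fintype.orderIsoFinOfCardEq _ (by rw [← Nat.card_eq_fintype_card, hm])
  exact ⟨fun i => (e i).1, fun i => (e i).2,
    fun a ha => ⟨e.symm ⟨a, ha⟩, congrArg Subtype.val (e.apply_symm_apply _)⟩,
    fun i j => e.le_iff_le⟩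

section

variable {μ : X ⟶ Z} {m : ℕ} (e : Enumeration μ (m + 1))

/-- The set of those consecutive pairs of elements of the source which `f` separates. -/
def cuts (f : X ⟶ Y) : Set (Fin m) := {i | fn f (e.elem i.castSucc) ≠ fn f (e.elem i.succ)}

/-- The fibres of the first factor of a factorization are intervals. -/
theorem fn_elem_eq_of_le {f : X ⟶ Y} {g : Y ⟶ Z} (h : f ≫ g = μ) {i j l : Fin (m + 1)}
    (hij : i ≤ j) (hjl : j ≤ l) (hil : fn f (e.elem i) = fn f (e.elem l)) :
    fn f (e.elem j) = fn f (e.elem i) := by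
  have h1 := (e.le_iff i j).mpr hij
  have h2 := (e.le_iff j l).mpr hjl
  exact Hom.antisymm g (hil ▸ le_of_comp_eq h h2) (le_of_comp_eq h h1)

/-- A factorization with more cuts separates more elements, since fibres are intervals. -/
theorem fn_elem_eq_of_cuts_subset {f : X ⟶ Y} {g : Y ⟶ Z} (h : f ≫ g = μ) {f' : X ⟶ Y'}
    (hc : cuts e f' ⊆ cuts e f) {i l : Fin (m + 1)} (hil : i ≤ l)
    (hf : fn f (e.elem i) = fn f (e.elem l)) : fn f' (e.elem i) = fn f' (e.elem l) := by
  induction l using Fin.induction with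
  | zero => rw [Fin.le_zero_iff.mp hil]
  | succ j ih =>
    rcases hil.eq_or_lt with rfl | hlt
    · rfl
    · have hij : i ≤ j.castSucc := Fin.le_castSucc_iff.mpr hlt
      have h1 := fn_elem_eq_of_le e h hij (Fin.castSucc_le_succ j) hf
      have h2 : j ∉ cuts e f' := fun hj => hc hj (h1.trans hf)
      exact (ih hij h1.symm).trans (not_not.mp h2)

theorem fn_eq_of_cuts_subset {f : X ⟶ Y} {g : Y ⟶ Z} (h : f ≫ g = μ) {f' : X ⟶ Y'}
    (hf : IsActive f) (hc : cuts e f' ⊆ cuts e f) {a b : X.pt.obj} (hab : fn f a = fn f b) :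
    fn f' a = fn f' b := by
  by_cases ha : a = base X
  · subst ha
    rw [hf b (hab.symm.trans (fn_base f))]
  by_cases hb : b = base X
  · exact absurd (hf a (hab.trans ((congrArg (fn f) hb).trans (fn_base f)))) ha
  obtain ⟨i, rfl⟩ := e.exists_elem a ha
  obtain ⟨j, rfl⟩ := e.exists_elem b hb
  rcases le_total i j with hij | hij
  · exact fn_elem_eq_of_cuts_subset e h hc hij hab
  · exact (fn_elem_eq_of_cuts_subset e h hc hij hab.symm).symm

theorem cuts_comp_subset (f : X ⟶ Y) (g : Y ⟶ Y') : cuts e (f ≫ g) ⊆ cuts e f :=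
  fun _ hi h => hi (congrArg (fn g) h)

/-- The map induced by an active morphism away from the base points. -/
def unpointedMap {f : X ⟶ Y} (hf : IsActive f) (a : X.pt.Unpointed) : Y.pt.Unpointed :=
  ⟨fn f a.1, hf.fn_ne a.2⟩

theorem one_lt_card_iff {f : X ⟶ Y} (hf : IsActive f)
    (hs : Function.Surjective (unpointedMap hf)) :
    1 < Nat.card Y.pt.Unpointed ↔ (cuts e f).Nonempty := by
  rw [Finite.one_lt_card_iff_nontrivial]
  constructor
  · rintro ⟨y, y', hne⟩
    by_contra hc
    have hconst (i : Fin (m + 1)) : fn f (e.elem i) = fn f (e.elem 0) := by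
      induction i using Fin.induction with
      | zero => rfl
      | succ j ih =>
        have : j ∉ cuts e f := fun hj => hc ⟨j, hj⟩
        exact (not_not.mp this).symm.trans ih
    obtain ⟨⟨a, ha⟩, rfl⟩ := hs y
    obtain ⟨⟨b, hb⟩, rfl⟩ := hs y'
    obtain ⟨i, rfl⟩ := e.exists_elem a ha
    obtain ⟨j, rfl⟩ := e.exists_elem b hb
    exact hne (Subtype.ext ((hconst i).trans (hconst j).symm))
  · rintro ⟨j, hj⟩
    exact ⟨unpointedMap hf ⟨_, e.elem_ne _⟩, unpointedMap hf ⟨_, e.elem_ne _⟩,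
      fun h => hj (congrArg Subtype.val h)⟩

theorem card_lt_card_iff {f : X ⟶ Y} {g : Y ⟶ Z} (h : f ≫ g = μ) (hf : IsActive f)
    (hs : Function.Surjective (unpointedMap hf)) :
    Nat.card Y.pt.Unpointed < Nat.card X.pt.Unpointed ↔ cuts e f ≠ Set.univ := by
  have hinj : Function.Injective (unpointedMap hf) ↔ cuts e f = Set.univ := by
    constructor
    · intro hi
      refine Set.eq_univ_of_forall fun j hj => ?_
      have h1 := hi (a₁ := ⟨_, e.elem_ne j.castSucc⟩) (a₂ := ⟨_, e.elem_ne j.succ⟩)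
        (Subtype.ext hj)
      exact (Fin.castSucc_lt_succ (i := j)).ne (e.elem_injective (congrArg Subtype.val h1))
    · rintro hc ⟨a, ha⟩ ⟨b, hb⟩ hab
      have hab' : fn f a = fn f b := congrArg Subtype.val hab
      -- A morphism separating all elements has no more cuts than `f`.
      exact Subtype.ext (fn_eq_of_cuts_subset (f' := 𝟙 X) e h hf
        (hc ▸ Set.subset_univ _) hab')
  rw [Ne, ← hinj]
  constructor
  · intro hlt hi
    exact absurd (Nat.card_le_card_of_injective _ hi) (not_le.mpr hlt)
  · intro hi
    refine lt_of_le_of_ne (Nat.card_le_card_of_surjective _ hs) fun hcard => hi ?_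
    exact ((Nat.bijective_iff_surjective_and_card _).mpr ⟨hs, hcard.symm⟩).1

end

end Assoc

/-! ### Factorizations with prescribed cuts -/

namespace Assoc

variable {X Z : Assoc.{u}} {μ : X ⟶ Z} {m : ℕ}

open Classical in
/-- The extension of a labelling of the enumerated elements to the base point, by `⊥`. -/
noncomputable def label (e : Enumeration μ m) (b : Fin m → ℕ) (a : X.pt.obj) : WithBot ℕ :=
  if h : ∃ i, e.elem i = a then (b h.choose : ℕ) else ⊥

theorem label_elem (e : Enumeration μ m) (b : Fin m → ℕ) (i : Fin m) :
    label e b (e.elem i) = (b i : ℕ) := by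
  have h : ∃ j, e.elem j = e.elem i := ⟨i, rfl⟩
  rw [label, dif_pos h, e.elem_injective h.choose_spec]

theorem label_base (e : Enumeration μ m) (b : Fin m → ℕ) : label e b (base X) = ⊥ :=
  dif_neg fun ⟨i, hi⟩ => e.elem_ne i hi

theorem label_eq_bot_iff (e : Enumeration μ m) (b : Fin m → ℕ) {a : X.pt.obj} :
    label e b a = ⊥ ↔ a = base X := by
  refine ⟨fun h => by_contra fun ha => ?_, fun h => h ▸ label_base e b⟩
  obtain ⟨i, rfl⟩ := e.exists_elem a ha
  rw [label_elem] at h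
  exact WithBot.coe_ne_bot h

/-- The pointed set of the labels which occur, including the label `⊥` of the base point. -/
noncomputable def labels (e : Enumeration μ m) (b : Fin m → ℕ) : Assoc.{u} where
  pt :=
    { obj := ⟨ULift.{u} (Set.range (label e b)), ⟨⟨_, base X, rfl⟩⟩⟩
      property :=
        have : Finite X.pt.obj := X.pt.property
        inferInstanceAs (Finite (ULift (Set.range (label e b)))) }

theorem labels_ne_base_iff (e : Enumeration μ m) (b : Fin m → ℕ) {y : (labels e b).pt.obj} :
    y ≠ base (labels e b) ↔ y.down.1 ≠ ⊥ := by
  refine not_congr ⟨fun h => ?_, fun h => ?_⟩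
  · rw [h]
    exact label_base e b
  · exact ULift.ext _ _ (Subtype.ext (h.trans (label_base e b).symm))

/-- The first factor: the map sending each element to its label. -/
noncomputable def toLabels (e : Enumeration μ m) (b : Fin m → ℕ) : X ⟶ labels e b where
  map := ⟨⟨fun a => ⟨⟨label e b a, a, rfl⟩⟩, rfl⟩⟩
  le a c := label e b a = label e b c ∧ Hom.le μ a c
  fiber := by
    rintro a c ⟨h, h'⟩
    exact ⟨ULift.ext _ _ (Subtype.ext h), (labels_ne_base_iff e b).mpr
      fun h'' => (ne_base_of_le h').1 ((label_eq_bot_iff e b).mp h'')⟩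
  refl a ha := by
    have ha' : a ≠ base X := by
      rintro rfl
      exact ha rfl
    obtain ⟨i, rfl⟩ := e.exists_elem a ha'
    exact ⟨rfl, (e.le_iff i i).mpr le_rfl⟩
  trans h₁ h₂ := ⟨h₁.1.trans h₂.1, Hom.trans μ h₁.2 h₂.2⟩
  antisymm h₁ h₂ := Hom.antisymm μ h₁.2 h₂.2
  total := by
    intro a c h ha
    have h' : label e b a = label e b c := congrArg (fun y => y.down.1) h
    have ha' : a ≠ base X := by
      rintro rfl
      exact ha rfl
    have hc' : c ≠ base X := fun hc =>
      ha' ((label_eq_bot_iff e b).mp (h'.trans ((label_eq_bot_iff e b).mpr hc)))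
    obtain ⟨i, rfl⟩ := e.exists_elem a ha'
    obtain ⟨j, rfl⟩ := e.exists_elem c hc'
    exact ((le_total i j).imp (fun l => ⟨h', (e.le_iff i j).mpr l⟩)
      (fun l => ⟨h'.symm, (e.le_iff j i).mpr l⟩))

open Classical in
/-- The second factor: the map sending all labels to the unique element `z`, with the ordering of
the labels as natural numbers. -/
noncomputable def ofLabels (e : Enumeration μ m) (b : Fin m → ℕ) {z : Z.pt.obj}
    (hz : z ≠ base Z) : labels e b ⟶ Z where
  map := ⟨⟨fun y => if y = base (labels e b) then base Z else z, if_pos rfl⟩⟩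
  le y y' := y.down.1 ≠ ⊥ ∧ y.down.1 ≤ y'.down.1
  fiber := by
    rintro y y' ⟨h, h'⟩
    have h1 : y ≠ base (labels e b) := (labels_ne_base_iff e b).mpr h
    have h2 : y' ≠ base (labels e b) := (labels_ne_base_iff e b).mpr
      fun h'' => h (le_bot_iff.mp (h''.symm ▸ h'))
    exact ⟨(if_neg h1).trans (if_neg h2).symm, fun h3 => hz ((if_neg h1).symm.trans h3)⟩
  refl y hy := ⟨(labels_ne_base_iff e b).mp fun h => hy (if_pos h), le_rfl⟩
  trans h₁ h₂ := ⟨h₁.1, h₁.2.trans h₂.2⟩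
  antisymm h₁ h₂ := ULift.ext _ _ (Subtype.ext (le_antisymm h₁.2 h₂.2))
  total := by
    intro y y' h hy
    have h1 : y ≠ base (labels e b) := fun h => hy (if_pos h)
    have h2 : y' ≠ base (labels e b) := fun h' => hy (h.trans (if_pos h'))
    exact (le_total y.down.1 y'.down.1).imp (fun l => ⟨(labels_ne_base_iff e b).mp h1, l⟩)
      (fun l => ⟨(labels_ne_base_iff e b).mp h2, l⟩)

theorem isActive_toLabels (e : Enumeration μ m) (b : Fin m → ℕ) : IsActive (toLabels e b) := by
  intro a ha
  by_contra h
  exact (labels_ne_base_iff e b (y := fn (toLabels e b) a)).mpr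
    (fun h' => h ((label_eq_bot_iff e b).mp h')) ha

theorem isActive_ofLabels (e : Enumeration μ m) (b : Fin m → ℕ) {z : Z.pt.obj}
    (hz : z ≠ base Z) : IsActive (ofLabels e b hz) := by
  intro y hy
  by_contra h
  exact hz ((if_neg h).symm.trans hy)

theorem surjective_toLabels (e : Enumeration μ m) (b : Fin m → ℕ) :
    Function.Surjective (unpointedMap (isActive_toLabels e b)) := by
  rintro ⟨⟨⟨_, a, rfl⟩⟩, hy⟩
  exact ⟨⟨a, fun h => hy (by subst h; rfl)⟩, rfl⟩

theorem toLabels_comp_ofLabels (hZ : IsUnary Z) (hμ : IsActive μ) (e : Enumeration μ m)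
    {b : Fin m → ℕ} (hb : Monotone b) {z : Z.pt.obj} (hz : z ≠ base Z) :
    toLabels e b ≫ ofLabels e b hz = μ := by
  refine hom_ext (fun a => ?_) fun a c => ⟨fun h => ?_, fun h => ?_⟩
  · by_cases ha : a = base X
    · rw [ha, fn_base, fn_base]
    · exact hZ _ _ ((isActive_ofLabels e b hz).fn_ne ((isActive_toLabels e b).fn_ne ha))
        (hμ.fn_ne ha)
  · obtain ⟨⟨h1, h2⟩, h3⟩ := h
    have h1' : label e b a ≠ ⊥ := h1
    have h2' : label e b a ≤ label e b c := h2
    have ha : a ≠ base X := fun h => h1' ((label_eq_bot_iff e b).mpr h)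
    have hc : c ≠ base X := fun h =>
      h1' (le_bot_iff.mp (h2'.trans ((label_eq_bot_iff e b).mpr h).le))
    by_cases hac : label e b a = label e b c
    · exact (h3 (ULift.ext _ _ (Subtype.ext hac))).2
    · obtain ⟨i, rfl⟩ := e.exists_elem a ha
      obtain ⟨j, rfl⟩ := e.exists_elem c hc
      rw [e.le_iff]
      by_contra hij
      refine hac (le_antisymm h2' ?_)
      rw [label_elem, label_elem]
      exact WithBot.coe_le_coe.mpr (hb (le_of_not_ge hij))
  · obtain ⟨ha, hc⟩ := ne_base_of_le h
    refine ⟨⟨fun h' => ha ((label_eq_bot_iff e b).mp h'), ?_⟩,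
      fun h' => ⟨congrArg (fun y => y.down.1) h', h⟩⟩
    obtain ⟨i, rfl⟩ := e.exists_elem a ha
    obtain ⟨j, rfl⟩ := e.exists_elem c hc
    change label e b _ ≤ label e b _
    rw [label_elem, label_elem]
    exact WithBot.coe_le_coe.mpr (hb ((e.le_iff i j).mp h))

open Classical in
/-- The number of elements of `s` before the position `i`. -/
noncomputable def countBefore (s : Set (Fin m)) (i : Fin (m + 1)) : ℕ :=
  (Finset.univ.filter fun j : Fin m => j ∈ s ∧ j.castSucc < i).card

theorem countBefore_mono (s : Set (Fin m)) : Monotone (countBefore s) := by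
  classical
  intro i i' h
  refine Finset.card_le_card fun j hj => ?_
  rw [Finset.mem_filter] at hj ⊢
  exact ⟨hj.1, hj.2.1, hj.2.2.trans_le h⟩

theorem countBefore_eq_iff (s : Set (Fin m)) (j : Fin m) :
    countBefore s j.castSucc = countBefore s j.succ ↔ j ∉ s := by
  classical
  constructor
  · intro h hj
    refine h.not_lt (Finset.card_lt_card ?_)
    rw [Finset.ssubset_iff_of_subset]
    · refine ⟨j, ?_, ?_⟩
      · rw [Finset.mem_filter]
        exact ⟨Finset.mem_univ _, hj, Fin.castSucc_lt_succ⟩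
      · rw [Finset.mem_filter]
        exact fun h => lt_irrefl _ h.2.2
    · intro i hi
      rw [Finset.mem_filter] at hi ⊢
      exact ⟨hi.1, hi.2.1, hi.2.2.trans Fin.castSucc_lt_succ⟩
  · intro hj
    refine congrArg Finset.card (Finset.filter_congr fun i _ => and_congr_right fun hi => ?_)
    rw [Fin.castSucc_lt_castSucc_iff, Fin.castSucc_lt_succ_iff]
    exact ⟨le_of_lt, fun h => lt_of_le_of_ne h fun h' => hj (h' ▸ hi)⟩

theorem cuts_toLabels {μ : X ⟶ Z} (e : Enumeration μ (m + 1)) (s : Set (Fin m)) :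
    cuts e (toLabels e (countBefore s)) = s := by
  ext j
  rw [← not_iff_not, ← countBefore_eq_iff s j, ← Nat.cast_inj (R := WithBot ℕ)]
  have h (i) : label e (countBefore s) (e.elem i) = ((countBefore s i : ℕ) : WithBot ℕ) :=
    label_elem e _ i
  rw [← h, ← h]
  refine not_not.trans ⟨fun h => congrArg (fun y => y.down.1) h, fun h => ?_⟩
  exact ULift.ext _ _ (Subtype.ext h)

/-! ### The partition category of a multi-morphism -/

/-- A factorization is a proper partition if and only if its first factor is surjective and its cut
set is non-empty and proper. -/
theorem isPartition_iff {X Y Z : Act toFinPtd.{u}} {μ : X ⟶ Z} (f : X ⟶ Y) (g : Y ⟶ Z)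
    (h : f ≫ g = μ) (e : Enumeration μ.hom (m + 1)) :
    IsPartition ((actToFin toFinPtd).obj X) (Under.mk ((actToFin toFinPtd).map f)) ↔
      Function.Surjective (unpointedMap f.property) ∧
        (cuts e f.hom).Nonempty ∧ cuts e f.hom ≠ Set.univ := by
  refine and_congr_right fun hs => ?_
  exact and_congr (one_lt_card_iff e f.property hs)
    (card_lt_card_iff e (congrArg InducedWideCategory.Hom.hom h) f.property hs)

variable {X Z : Act toFinPtd.{u}} {μ : X ⟶ Z}

/-- The first factor of a factorization. -/
abbrev fstFactor (A : FactCat μ) : X ⟶ A.right.left := A.hom.left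

/-- The second factor of a factorization. -/
abbrev sndFactor (A : FactCat μ) : A.right.left ⟶ Z := A.right.hom

theorem fst_comp_snd (A : FactCat μ) : fstFactor A ≫ sndFactor A = μ := Over.w A.hom

theorem partCat_property (e : Enumeration μ.hom (m + 1)) (A : PartCat μ) :
    Function.Surjective (unpointedMap (fstFactor A.obj).property) ∧
        (cuts e (fstFactor A.obj).hom).Nonempty ∧ cuts e (fstFactor A.obj).hom ≠ Set.univ :=
  (isPartition_iff _ _ (fst_comp_snd A.obj) e).mp A.property

/-- The functor sending a partition to its set of cuts. -/
def cutsFunctor (e : Enumeration μ.hom (m + 1)) : PartCat μ ⥤ (ProperSubset (Fin m))ᵒᵖ where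
  obj A := Opposite.op ⟨cuts e (fstFactor A.obj).hom, (partCat_property e A).2⟩
  map {A B} φ := (homOfLE (by
    have h : fstFactor A.obj ≫ φ.hom.right.left = fstFactor B.obj :=
      congrArg CommaMorphism.left (Under.w φ.hom)
    change cuts e (fstFactor B.obj).hom ⊆ cuts e (fstFactor A.obj).hom
    rw [← h]
    exact cuts_comp_subset e _ _)).op

theorem isSurj_of_surjective_unpointedMap {X Y : Assoc.{u}} {f : X ⟶ Y} (hf : IsActive f)
    (h : Function.Surjective (unpointedMap hf)) : IsSurj f := fun b hb => by
  obtain ⟨a, ha⟩ := h ⟨b, hb⟩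
  exact ⟨a.1, congrArg Subtype.val ha⟩

theorem cutsFunctor_faithful (e : Enumeration μ.hom (m + 1)) : (cutsFunctor e).Faithful where
  map_injective {A B} φ ψ _ := by
    have hs := (isSurj_of_surjective_unpointedMap _ (partCat_property e A).1).surjective
    have h (φ : A ⟶ B) : fstFactor A.obj ≫ φ.hom.right.left = fstFactor B.obj :=
      congrArg CommaMorphism.left (Under.w φ.hom)
    have h' (φ : A ⟶ B) : φ.hom.right.left ≫ sndFactor B.obj = sndFactor A.obj :=
      Over.w φ.hom.right
    refine ObjectProperty.hom_ext _ (Under.UnderMorphism.ext (Over.OverMorphism.ext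
      (WideSubcategory.hom_ext _ (eq_of_comp_eq (sndFactor B.obj).property
        (congrArg InducedWideCategory.Hom.hom ((h' φ).trans (h' ψ).symm)) fun b => ?_))))
    obtain ⟨a, rfl⟩ := hs b
    have h1 := congrArg InducedWideCategory.Hom.hom ((h φ).trans (h ψ).symm)
    exact congrArg (fun f => fn f a) h1

theorem cutsFunctor_full (hZ : IsUnary Z.obj) (e : Enumeration μ.hom (m + 1)) :
    (cutsFunctor e).Full where
  map_surjective {A B} φ := by
    have hs := isSurj_of_surjective_unpointedMap _ (partCat_property e A).1
    have hA : (fstFactor A.obj).hom ≫ (sndFactor A.obj).hom = μ.hom :=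
      congrArg InducedWideCategory.Hom.hom (fst_comp_snd A.obj)
    have hB : (fstFactor B.obj).hom ≫ (sndFactor B.obj).hom = μ.hom :=
      congrArg InducedWideCategory.Hom.hom (fst_comp_snd B.obj)
    have hc : cuts e (fstFactor B.obj).hom ⊆ cuts e (fstFactor A.obj).hom := leOfHom φ.unop
    obtain ⟨h, hact, h1, h2⟩ := exists_factor hZ hA hB (fstFactor A.obj).property
      (sndFactor A.obj).property (fstFactor B.obj).property (sndFactor B.obj).property hs
      fun a b hab => fn_eq_of_cuts_subset e hA (fstFactor A.obj).property hc hab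
    let h' : A.obj.right.left ⟶ B.obj.right.left := ⟨h, hact⟩
    refine ⟨ObjectProperty.homMk (Under.homMk (Over.homMk h' (WideSubcategory.hom_ext _ h2))
      (Over.OverMorphism.ext (WideSubcategory.hom_ext _ h1))), Subsingleton.elim _ _⟩

theorem cutsFunctor_essSurj (hZ : IsUnary Z.obj) {z : Z.obj.pt.obj} (hz : z ≠ base Z.obj)
    (e : Enumeration μ.hom (m + 1)) : (cutsFunctor e).EssSurj where
  mem_essImage s := by
    obtain ⟨s⟩ := s
    let Y : Act toFinPtd.{u} := ⟨labels e (countBefore s.1)⟩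
    let f : X ⟶ Y := ⟨toLabels e _, isActive_toLabels e _⟩
    let g : Y ⟶ Z := ⟨ofLabels e _ hz, isActive_ofLabels e _ hz⟩
    have h : f ≫ g = μ := WideSubcategory.hom_ext _
      (toLabels_comp_ofLabels hZ μ.property e (countBefore_mono s.1) hz)
    have hcuts : cuts e f.hom = s.1 := cuts_toLabels e s.1
    let A : PartCat μ := ⟨Under.mk (Y := Over.mk g) (Over.homMk f h),
      (isPartition_iff f g h e).mpr ⟨surjective_toLabels e _, hcuts ▸ s.2⟩⟩
    exact ⟨A, ⟨eqToIso (congrArg Opposite.op (Subtype.ext hcuts))⟩⟩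

end Assoc

theorem isUnary_of_card_eq_one {Z : Assoc.{u}} (h : Nat.card Z.pt.Unpointed = 1) :
    Assoc.IsUnary Z := fun a b ha hb => by
  have := (Nat.card_eq_one_iff_unique.mp h).1
  exact congrArg Subtype.val (this.elim ⟨a, ha⟩ ⟨b, hb⟩)

/-- The partition category of a multi-morphism of positive arity is equivalent to the opposite of
the poset of cut sets. -/
theorem nonempty_partCat_equivalence {m : ℕ} (γ : MultiMorphism Assoc.toFinPtd.{u} (m + 1)) :
    Nonempty (PartCat γ.hom ≌ (ProperSubset (Fin m))ᵒᵖ) := by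
  have hZ : Assoc.IsUnary γ.target.obj := isUnary_of_card_eq_one γ.card_target
  obtain ⟨⟨z, hz⟩⟩ := (Nat.card_eq_one_iff_unique.mp γ.card_target).2
  obtain ⟨e⟩ := Assoc.exists_enumeration hZ γ.hom.property γ.card_source
  have := Assoc.cutsFunctor_faithful e
  have := Assoc.cutsFunctor_full hZ e
  have := Assoc.cutsFunctor_essSurj hZ hz e
  have : (Assoc.cutsFunctor e).IsEquivalence := {}
  exact ⟨(Assoc.cutsFunctor e).asEquivalence⟩

theorem mainTheorem9 (k : ℕ) (hk : 2 ≤ k) (γ : MultiMorphism Assoc.toFinPtd.{u} k) :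
    Nonempty (ContinuousMap.HomotopyEquiv (partitionComplex γ.hom)
      (Metric.sphere (0 : EuclideanSpace ℝ (Fin (k - 2))) 1)) ∧
    Nonempty (PartCat γ.hom ≌ {s : Set (Fin (k - 1)) // s.Nonempty ∧ s ≠ Set.univ}ᵒᵖ) := by
  obtain ⟨d, rfl⟩ : ∃ d, k = d + 1 + 1 := ⟨k - 2, by omega⟩
  obtain ⟨E⟩ := nonempty_partCat_equivalence γ
  refine ⟨?_, ⟨E⟩⟩
  let _ : Fintype (ProperSubset (Fin (d + 1))) := Fintype.ofFinite _
  obtain ⟨H⟩ := Realization.nonempty_homotopyEquiv_orderComplex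
    (E.trans (orderDualEquivalence (ProperSubset (Fin (d + 1)))).symm)
  exact ⟨H.trans ((OrderComplex.orderDual _).trans
    ProperSubset.homeomorphSphere).toHomotopyEquiv⟩
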